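/- Let $K$ be a field, let $0<a<b<c$ be integers with $\gcd(a,b,c)=1$ and $a+b<c$, let $I=(x^c,\,x^by^a,\,x^ay^b,\,y^c)\subset K[x,y]$ and $\mathfrak m=(x,y)$. Let $F(I)=\bigoplus_{n\ge 0}I^n/\mathfrak m I^n$ be the fiber cone of $I$, and let $J$ be the kernel of the $K$-algebra homomorphism $K[z_1,z_2,z_3,z_4]\to F(I)$ which sends $z_1,z_2,z_3,z_4$ to the classes in $I/\mathfrak m I$ of $x^c,\ x^by^a,\ x^ay^b,\ y^c$, respectively. Let $\mathcal S$ be the set of pairs $(i,j)$ of positive integers with $$\frac{b-a}{c-b}\,j\le i\le \frac{b-a}{a}\,j,$$ ordered componentwise. Then $\mathcal S$ has a least element $(i,j)$. Put $\ell=\frac{b-a}{\gcd(c,b-a)}$ and $m=\frac{c}{\gcd(c,b-a)}$. (a) $J$ has a minimal generating set of one of the following four forms: (i) $z_1z_4,\ z_1^iz_3^j,\ z_2^jz_4^i$; (ii) $z_1z_4,\ z_1^iz_3^j,\ z_2^jz_4^i$, and the monomials $z_1^{i'}z_3^{j'}$, $z_2^{j'}z_4^{i'}$ for $(i',j')$ in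 a nonempty finite set of pairs of positive integers not containing $(i,j)$; (iii) $z_1z_4,\ z_1^iz_3^j,\ z_2^jz_4^i,\ z_1^\ell z_3^m-z_2^mz_4^\ell$; (iv) $z_1z_4,\ z_1^iz_3^j,\ z_2^jz_4^i,\ z_1^\ell z_3^m-z_2^mz_4^\ell$, and the monomials $z_1^{i'}z_3^{j'}$, $z_2^{j'}z_4^{i'}$ for $(i',j')$ in a nonempty finite set of pairs of positive integers not containing $(i,j)$. Over every field $K$, each of the four cases occurs for some such $a,b,c$. (b) $F(I)$ is Cohen–Macaulay if and only if $J$ is minimally generated as in (i), that is, $J=(z_1z_4,\,z_1^iz_3^j,\,z_2^jz_4^i)$. Otherwise $\operatorname{depth}F(I)=1$. -/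

import Mathlib

open MvPolynomial

noncomputable section

namespace SymmetricFiberCone

/-! ### Fiber cones -/

section General

variable {S : Type*} [CommRing S]

/-- The fiber cone `F(I) = R(I) / 𝔪 R(I) = ⨁ I ^ n / 𝔪 I ^ n`, where `R(I) = ⨁ I ^ n t ^ n` is the
Rees algebra of `I`. -/
abbrev FiberCone (𝔪 I : Ideal S) : Type _ :=
  reesAlgebra I ⧸ 𝔪.map (algebraMap S (reesAlgebra I))

/-- For `u ∈ I`, the class `u + 𝔪 I` in the degree one component `I / 𝔪 I` of `F(I)`,
that is, the class of `u t ∈ R(I)`. -/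
def FiberCone.degreeOne (𝔪 I : Ideal S) (u : S) (hu : u ∈ I) : FiberCone 𝔪 I :=
  Ideal.Quotient.mk _
    ⟨Polynomial.monomial 1 u, reesAlgebra.monomial_mem.mpr ((pow_one I).symm ▸ hu)⟩

/-- The irrelevant ideal `F(I)₊ = ⨁_{n > 0} I ^ n / 𝔪 I ^ n` of the fiber cone: the image of the
ideal `⨁_{n > 0} I ^ n t ^ n` of the Rees algebra. When `𝔪` is maximal it is the graded maximal
ideal of `F(I)`. -/
def FiberCone.irrelevant (𝔪 I : Ideal S) : Ideal (FiberCone 𝔪 I) :=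
  (RingHom.ker ((Polynomial.constantCoeff (R := S)).comp
    (reesAlgebra I).val.toRingHom)).map (Ideal.Quotient.mk _)

/-- The supremum of the lengths of the regular sequences on `R` with all members in `𝔞`. -/
def depthIn {R : Type*} [CommRing R] (𝔞 : Ideal R) : ℕ∞ :=
  ⨆ (rs : List R) (_ : (∀ r ∈ rs, r ∈ 𝔞) ∧ RingTheory.Sequence.IsRegular R rs),
    (rs.length : ℕ∞)

/-- The depth of the fiber cone as a graded ring, with respect to its graded maximal ideal. -/
def FiberCone.depth (𝔪 I : Ideal S) : ℕ∞ := depthIn (R := FiberCone 𝔪 I) (FiberCone.irrelevant 𝔪 I)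

/-- The standard graded algebra `F(I)` is Cohen–Macaulay: its depth equals its Krull dimension. -/
def FiberCone.IsCohenMacaulay (𝔪 I : Ideal S) : Prop :=
  (FiberCone.depth 𝔪 I : WithBot ℕ∞) = ringKrullDim (FiberCone 𝔪 I)

/-- `G` is a minimal (irredundant) generating set of the ideal `J`. -/
def IsMinimalGeneratingSet (J : Ideal S) (G : Set S) : Prop :=
  Ideal.span G = J ∧ ∀ g ∈ G, g ∉ Ideal.span (G \ {g})

end General

/-! ### Symmetric ideals with four generators -/

section Symmetric

variable (K : Type*) [Field K]

/-- The graded maximal ideal `(x, y)` of `K[x, y]`, with `x = X 0` and `y = X 1`. -/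
def maxIdeal : Ideal (MvPolynomial (Fin 2) K) := Ideal.span {X 0, X 1}

variable (a b c : ℕ)

/-- The monomials `u₁ = x^c`, `u₂ = x^b y^a`, `u₃ = x^a y^b`, `u₄ = y^c` (indexed from `0`). -/
def symmGen : Fin 4 → MvPolynomial (Fin 2) K :=
  ![X 0 ^ c, X 0 ^ b * X 1 ^ a, X 0 ^ a * X 1 ^ b, X 1 ^ c]

/-- The symmetric ideal `I = (x^c, x^b y^a, x^a y^b, y^c)` of `K[x, y]`. -/
def symmIdeal : Ideal (MvPolynomial (Fin 2) K) := Ideal.span (Set.range (symmGen K a b c))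

/-- The canonical homomorphism `T = K[z₁, z₂, z₃, z₄] → F(I)` with `z_k ↦ u_k + 𝔪 I`; here `z_k` is
`X (k - 1)`. -/
def presentation :
    MvPolynomial (Fin 4) K →ₐ[K] FiberCone (maxIdeal K) (symmIdeal K a b c) :=
  aeval fun k => FiberCone.degreeOne (maxIdeal K) (symmIdeal K a b c) (symmGen K a b c k)
    (Ideal.subset_span (Set.mem_range_self k))

/-- The defining ideal `J` of the fiber cone `F(I)`. -/
def definingIdeal : Ideal (MvPolynomial (Fin 4) K) := RingHom.ker (presentation K a b c)

/-- The set of pairs `(i, j)` of positive integers with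
`(b - a) / (c - b) * j ≤ i ≤ (b - a) / a * j`; it is ordered componentwise. -/
def posetS : Set (ℕ × ℕ) :=
  {p | 0 < p.1 ∧ 0 < p.2 ∧
    ((b : ℚ) - a) / ((c : ℚ) - b) * p.2 ≤ p.1 ∧ (p.1 : ℚ) ≤ ((b : ℚ) - a) / a * p.2}

/-- The three monomials `z₁ z₄`, `z₁^i z₃^j`, `z₂^j z₄^i`. -/
def baseGens (i j : ℕ) : Set (MvPolynomial (Fin 4) K) :=
  {X 0 * X 3, X 0 ^ i * X 2 ^ j, X 1 ^ j * X 3 ^ i}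

/-- The monomials `z₁^i' z₃^j'` and `z₂^j' z₄^i'` with `(i', j') ∈ E`. -/
def extraGens (E : Finset (ℕ × ℕ)) : Set (MvPolynomial (Fin 4) K) :=
  {f | ∃ p ∈ E, f = X 0 ^ p.1 * X 2 ^ p.2 ∨ f = X 1 ^ p.2 * X 3 ^ p.1}

/-- The binomial `z₁^ℓ z₃^m - z₂^m z₄^ℓ` with `ℓ = (b - a) / gcd (c, b - a)` and
`m = c / gcd (c, b - a)`; it is used for `a < b` only, and both divisions are exact. -/
def binom : MvPolynomial (Fin 4) K :=
  X 0 ^ ((b - a) / Nat.gcd c (b - a)) * X 2 ^ (c / Nat.gcd c (b - a)) -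
    X 1 ^ (c / Nat.gcd c (b - a)) * X 3 ^ ((b - a) / Nat.gcd c (b - a))

/-- `E` is a nonempty finite set of pairs of positive integers other than `(i, j)`. -/
def IsExtra (i j : ℕ) (E : Finset (ℕ × ℕ)) : Prop :=
  E.Nonempty ∧ (i, j) ∉ E ∧ ∀ p ∈ E, 0 < p.1 ∧ 0 < p.2

variable (i j : ℕ)

/-- `J` is minimally generated by `z₁ z₄`, `z₁^i z₃^j`, `z₂^j z₄^i`. -/
def CaseI : Prop := IsMinimalGeneratingSet (definingIdeal K a b c) (baseGens K i j)

/-- `J` is minimally generated by `z₁ z₄`, `z₁^i z₃^j`, `z₂^j z₄^i` together with further monomials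
`z₁^i' z₃^j'` and `z₂^j' z₄^i'`. -/
def CaseII : Prop := ∃ E : Finset (ℕ × ℕ), IsExtra i j E ∧
  IsMinimalGeneratingSet (definingIdeal K a b c) (baseGens K i j ∪ extraGens K E)

/-- `J` is minimally generated by `z₁ z₄`, `z₁^i z₃^j`, `z₂^j z₄^i` and the binomial. -/
def CaseIII : Prop :=
  IsMinimalGeneratingSet (definingIdeal K a b c) (baseGens K i j ∪ {binom K a b c})

/-- `J` is minimally generated by `z₁ z₄`, `z₁^i z₃^j`, `z₂^j z₄^i`, the binomial and further
monomials `z₁^i' z₃^j'` and `z₂^j' z₄^i'`. -/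
def CaseIV : Prop := ∃ E : Finset (ℕ × ℕ), IsExtra i j E ∧
  IsMinimalGeneratingSet (definingIdeal K a b c)
    (baseGens K i j ∪ {binom K a b c} ∪ extraGens K E)

end Symmetric

/-- The standing assumptions `0 < a < b < c`, `gcd (a, b, c) = 1` and `a + b < c`. -/
def Admissible (a b c : ℕ) : Prop :=
  0 < a ∧ a < b ∧ b < c ∧ Nat.gcd (Nat.gcd a b) c = 1 ∧ a + b < c

end SymmetricFiberCone

end

/-!
Call an exponent `α ∈ ℕ⁴` dead if the product of generators `u ^ α` is strictly divisible by
another product of `|α|` generators. Since `𝔪 I ^ n` is a monomial ideal, the fiber cone has the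
live products as a basis, so `J` is spanned by the dead monomials and by the differences of live
monomials with the same product (`sum_coeff_eq_zero_of_mem`). The vectors of relations among the
products are the multiples of `(ℓ, -m, m, -ℓ)`, and a live product only allows this vector once
(`eq_of_uExp_eq`). Hence `J` is generated by the dead monomials and the binomial
(`definingIdeal_eq`).

Comparing weights along the edges of the Newton polygon of `I`, which are strictly convex at its
vertices because `a + b < c`, one sees that every dead monomial is a multiple of `z₁ z₄`, of some
`z₁ ^ p * z₃ ^ r` with `u₁ ^ p * u₃ ^ r` strictly divisible by `u₂ ^ (p + r - s) * u₄ ^ s`, or of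
the mirror image of such a monomial (`exists_dominated_of_dead`, `dead_iff`). Such a domination
gives the point `(p + s, r - s)` of `S`. So the least element `(i, j)` of `S` yields a minimal
dead monomial, and all others have a larger exponent of `z₃`. The minimal generators are now the
minimal dead monomials, together with the binomial if its leading monomial `z₁ ^ ℓ * z₃ ^ m` is
alive; in that case dead multiples of `z₁ ^ ℓ * z₃ ^ m` are superfluous, since
`z₁ ^ (ℓ + 1) * z₃ ^ m` is a combination of the binomial and of `z₁ z₄`. As `(2ℓ, m - ℓ) ∈ S`, one
has `j < m`, so `z₁ ^ i * z₃ ^ j` is not among them.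

The fiber cone has dimension two, and `z₂ + z₃` is always regular on it
(`mem_definingIdeal_of_mul`). If `J` is generated by the three base monomials, then `z₁ + z₂ + z₄`
is regular modulo `z₂ + z₃` (`mem_foldIdeal_of_mul`) and the depth is two. Otherwise the quotient
by `z₂ + z₃` has a nonzero socle (`exists_socle`): a corner of the staircase of live monomials in
`z₁`, `z₃`, or, if the binomial leaves no such corner, the element
`z₁ ^ ℓ * z₃ ^ (m - 1) + z₂ ^ (m - 1) * z₄ ^ ℓ`. This forces depth one (`depthIn_eq_one`).
-/

open MvPolynomial

namespace SymmetricFiberCone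

/-! ### Depth and regular sequences -/

section Depth

variable {R : Type*} [CommRing R]

lemma isSMulRegular_quotient_iff {I : Ideal R} {r : R} :
    IsSMulRegular (R ⧸ I) r ↔ ∀ x, r * x ∈ I → x ∈ I := by
  rw [isSMulRegular_iff_right_eq_zero_of_smul]
  constructor
  · intro h x hx
    have := h (Ideal.Quotient.mk I x) (by
      rw [← Ideal.Quotient.mk_eq_mk, ← Submodule.Quotient.mk_smul, smul_eq_mul]
      exact (Submodule.Quotient.mk_eq_zero I).2 hx)
    exact Ideal.Quotient.eq_zero_iff_mem.1 this
  · intro h y hy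
    obtain ⟨x, rfl⟩ := Ideal.Quotient.mk_surjective y
    rw [Ideal.Quotient.eq_zero_iff_mem]
    apply h
    rw [← Ideal.Quotient.mk_eq_mk, ← Submodule.Quotient.mk_smul, smul_eq_mul] at hy
    exact (Submodule.Quotient.mk_eq_zero I).1 hy

lemma isRegular_iff_forall {rs : List R} :
    RingTheory.Sequence.IsRegular R rs ↔
      (∀ (k : ℕ) (h : k < rs.length) (x : R),
        rs[k] * x ∈ Ideal.ofList (rs.take k) → x ∈ Ideal.ofList (rs.take k)) ∧
      Ideal.ofList rs ≠ ⊤ := by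
  have key : ∀ I : Ideal R, (I • ⊤ : Submodule R R) = I := fun I => by
    rw [smul_eq_mul, Ideal.mul_top]
  constructor
  · rintro ⟨⟨h1⟩, h2⟩
    refine ⟨fun k hk => ?_, fun h => h2 (by rw [key, h])⟩
    have := h1 k hk
    rw [key] at this
    exact isSMulRegular_quotient_iff.1 this
  · rintro ⟨h1, h2⟩
    refine ⟨⟨fun k hk => ?_⟩, fun h => h2 (by rw [key] at h; exact h.symm)⟩
    rw [key]
    exact isSMulRegular_quotient_iff.2 (h1 k hk)

/-- A regular sequence is no longer than the Krull dimension: each member lowers the dimension of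
the successive quotients by at least one. -/
lemma length_le_ringKrullDim_of_isRegular {rs : List R}
    (h : RingTheory.Sequence.IsRegular R rs) : (rs.length : WithBot ℕ∞) ≤ ringKrullDim R := by
  rw [isRegular_iff_forall] at h
  obtain ⟨h1, h2⟩ := h
  have step : ∀ k, k ≤ rs.length →
      ringKrullDim (R ⧸ Ideal.ofList (rs.take k)) + (k : WithBot ℕ∞) ≤ ringKrullDim R := by
    intro k
    induction k with
    | zero => intro _; rw [Nat.cast_zero, add_zero]; exact ringKrullDim_quotient_le _
    | succ k ih =>
      intro hk
      have hlt : k < rs.length := hk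
      have htake : Ideal.ofList (rs.take (k + 1)) =
          Ideal.ofList (rs.take k) ⊔ Ideal.span {rs[k]} := by
        rw [List.take_succ_eq_append_getElem hlt, Ideal.ofList_append, Ideal.ofList_singleton]
      have hle : Ideal.ofList (rs.take k) ≤ Ideal.ofList (rs.take (k + 1)) := by
        rw [htake]; exact le_sup_left
      have := ringKrullDim_succ_le_of_surjective (Ideal.Quotient.factor hle)
        (Ideal.Quotient.factor_surjective hle) (r := Ideal.Quotient.mk _ rs[k])
        (by
          rw [mem_nonZeroDivisors_iff_right]
          intro y hy
          obtain ⟨x, rfl⟩ := Ideal.Quotient.mk_surjective y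
          rw [← map_mul, Ideal.Quotient.eq_zero_iff_mem, mul_comm] at hy
          exact Ideal.Quotient.eq_zero_iff_mem.2 (h1 k hlt x hy))
        (by
          rw [Ideal.Quotient.factor_mk, Ideal.Quotient.eq_zero_iff_mem, htake]
          exact Ideal.mem_sup_right (Ideal.mem_span_singleton_self _))
      refine le_trans ?_ (ih hlt.le)
      calc _ = ringKrullDim (R ⧸ Ideal.ofList (rs.take (k + 1))) + 1 + (k : WithBot ℕ∞) := by
            push_cast; rw [add_assoc, add_comm (1 : WithBot ℕ∞)]
        _ ≤ _ := by gcongr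
  have h3 := step rs.length le_rfl
  rw [List.take_length] at h3
  have : Nontrivial (R ⧸ Ideal.ofList rs) := Ideal.Quotient.nontrivial_iff.2 h2
  calc (rs.length : WithBot ℕ∞) = 0 + (rs.length : WithBot ℕ∞) := (zero_add _).symm
    _ ≤ _ := by gcongr; exact ringKrullDim_nonneg_of_nontrivial
    _ ≤ _ := h3

lemma length_le_depthIn {𝔞 : Ideal R} {rs : List R} (h : ∀ r ∈ rs, r ∈ 𝔞)
    (hrs : RingTheory.Sequence.IsRegular R rs) : (rs.length : ℕ∞) ≤ depthIn 𝔞 :=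
  le_iSup₂_of_le rs ⟨h, hrs⟩ le_rfl

lemma depthIn_le {𝔞 : Ideal R} {n : ℕ} (h : ∀ rs : List R, (∀ r ∈ rs, r ∈ 𝔞) →
    RingTheory.Sequence.IsRegular R rs → rs.length ≤ n) : depthIn 𝔞 ≤ n :=
  iSup₂_le fun rs hrs => by exact_mod_cast h rs hrs.1 hrs.2

/-- In Krull dimension two, a regular sequence of length two in `𝔞` is as long as possible. -/
lemma depthIn_eq_two {𝔞 : Ideal R} (hdim : ringKrullDim R = 2) (h𝔞 : 𝔞 ≠ ⊤) {x y : R}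
    (hx : x ∈ 𝔞) (hy : y ∈ 𝔞) (hxreg : ∀ z, x * z = 0 → z = 0)
    (hyreg : ∀ z, y * z ∈ Ideal.span {x} → z ∈ Ideal.span {x}) : depthIn 𝔞 = 2 := by
  refine le_antisymm (depthIn_le (n := 2) fun rs _ hrs => ?_) ?_
  · have := length_le_ringKrullDim_of_isRegular hrs
    rw [hdim] at this
    exact_mod_cast this
  · refine length_le_depthIn (rs := [x, y]) (by simp [hx, hy]) (isRegular_iff_forall.2 ⟨?_, ?_⟩)
    · intro k hk z hz
      have : k = 0 ∨ k = 1 := by simp at hk; omega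
      rcases this with rfl | rfl
      · simp only [List.take_zero, Ideal.ofList_nil, Ideal.mem_bot] at hz ⊢
        exact hxreg z hz
      · simp only [List.take_succ_cons, List.take_zero, Ideal.ofList_singleton] at hz ⊢
        exact hyreg z hz
    · intro htop
      refine h𝔞 (top_le_iff.1 (htop ▸ ?_))
      rw [Ideal.ofList, Ideal.span_le]
      intro r hr
      simp only [List.mem_cons, List.not_mem_nil, or_false, Set.mem_ofPred_eq] at hr
      rcases hr with rfl | rfl <;> assumption

/-- If some `w` outside `(θ)` is multiplied into `(θ)` by all of `𝔞`, where `θ ∈ 𝔞` is regular, then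
the depth is one. For another regular `f ∈ 𝔞` write `f w = θ v`; then `v` plays for `f` the role
that `w` plays for `θ`, so no further element of `𝔞` is regular modulo `f`. -/
lemma depthIn_eq_one {𝔞 : Ideal R} (h𝔞 : 𝔞 ≠ ⊤) {θ w : R} (hθ : θ ∈ 𝔞)
    (hreg : ∀ z, θ * z = 0 → z = 0) (hw : w ∉ Ideal.span {θ})
    (hsoc : ∀ z ∈ 𝔞, z * w ∈ Ideal.span {θ}) : depthIn 𝔞 = 1 := by
  refine le_antisymm (depthIn_le (n := 1) fun rs hmem hrs => ?_) ?_
  · rw [isRegular_iff_forall] at hrs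
    by_contra! hlen
    obtain ⟨f, g, l, rfl⟩ : ∃ f g l, rs = f :: g :: l := by
      match rs, hlen with
      | f :: g :: l, _ => exact ⟨f, g, l, rfl⟩
    have hf := hrs.1 0 (by simp)
    have hg := hrs.1 1 (by simp)
    simp only [List.getElem_cons_zero, List.take_zero, Ideal.ofList_nil, Ideal.mem_bot] at hf
    simp only [List.getElem_cons_succ, List.getElem_cons_zero, List.take_succ_cons, List.take_zero,
      Ideal.ofList_singleton] at hg
    obtain ⟨v, hv⟩ := Ideal.mem_span_singleton'.1 (hsoc f (hmem f (by simp)))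
    obtain ⟨u, hu⟩ := Ideal.mem_span_singleton'.1 (hsoc g (hmem g (by simp)))
    have hvf : v ∈ Ideal.span {f} := by
      refine hg v (Ideal.mem_span_singleton'.2 ⟨u, ?_⟩)
      have : θ * (u * f - g * v) = 0 := by linear_combination f * hu - g * hv
      exact sub_eq_zero.1 (hreg _ this)
    obtain ⟨t, ht⟩ := Ideal.mem_span_singleton'.1 hvf
    refine hw (Ideal.mem_span_singleton'.2 ⟨t, ?_⟩)
    have : f * (t * θ - w) = 0 := by linear_combination θ * ht + hv
    exact sub_eq_zero.1 (hf _ this)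
  · refine length_le_depthIn (rs := [θ]) (by simp [hθ]) (isRegular_iff_forall.2 ⟨?_, ?_⟩)
    · intro k hk z hz
      have : k = 0 := by simp at hk; omega
      subst this
      simp only [List.take_zero, Ideal.ofList_nil, Ideal.mem_bot] at hz ⊢
      exact hreg z hz
    · intro htop
      rw [Ideal.ofList_singleton] at htop
      refine h𝔞 (top_le_iff.1 (htop ▸ ?_))
      rwa [Ideal.span_singleton_le_iff_mem]

end Depth

/-! ### Monomials of `T` and the products of generators that they stand for -/

section Exponents

variable (a b c : ℕ)

/-- The exponent of `u₁ ^ α₀ * u₂ ^ α₁ * u₃ ^ α₂ * u₄ ^ α₃` as a monomial of `K[x, y]`. -/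
noncomputable def uExp (α : Fin 4 →₀ ℕ) : Fin 2 →₀ ℕ :=
  Finsupp.single 0 (c * α 0 + b * α 1 + a * α 2) + Finsupp.single 1 (a * α 1 + b * α 2 + c * α 3)

/-- The exponent `α` is dead if the product of generators `u ^ α` is strictly divisible by another
product of as many generators. These are the exponents of the monomials in the defining ideal. -/
def Dead (α : Fin 4 →₀ ℕ) : Prop := ∃ β, β.degree = α.degree ∧ uExp a b c β < uExp a b c α

lemma uExp_zero (α : Fin 4 →₀ ℕ) : uExp a b c α 0 = c * α 0 + b * α 1 + a * α 2 := by
  simp [uExp]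

lemma uExp_one (α : Fin 4 →₀ ℕ) : uExp a b c α 1 = a * α 1 + b * α 2 + c * α 3 := by
  simp [uExp]

lemma uExp_add (α β : Fin 4 →₀ ℕ) : uExp a b c (α + β) = uExp a b c α + uExp a b c β := by
  ext k; fin_cases k <;> simp [uExp] <;> ring

lemma degree_fin_four (α : Fin 4 →₀ ℕ) : α.degree = α 0 + α 1 + α 2 + α 3 := by
  rw [Finsupp.degree_eq_sum, Fin.sum_univ_four]

variable {a b c}

lemma Dead.add {α : Fin 4 →₀ ℕ} (h : Dead a b c α) (γ : Fin 4 →₀ ℕ) : Dead a b c (α + γ) := by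
  obtain ⟨β, h1, h2⟩ := h
  refine ⟨β + γ, by simp [h1], ?_⟩
  rw [uExp_add, uExp_add]
  exact add_lt_add_left h2 _

lemma Dead.mono {α β : Fin 4 →₀ ℕ} (h : Dead a b c α) (hle : α ≤ β) : Dead a b c β := by
  rw [← add_tsub_cancel_of_le hle]; exact h.add _

lemma dead_congr {α β : Fin 4 →₀ ℕ} (h1 : α.degree = β.degree) (h2 : uExp a b c α = uExp a b c β) :
    Dead a b c α ↔ Dead a b c β := by
  simp only [Dead, h1, h2]

end Exponents

/-! ### The fiber cone and its defining ideal -/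

section FiberConeGeneral

variable {S : Type*} [CommRing S]

lemma FiberCone.coeff_mem_of_mk_eq_zero {𝔪 I : Ideal S} {x : reesAlgebra I}
    (h : (Ideal.Quotient.mk (𝔪.map (algebraMap S (reesAlgebra I)))) x = 0) (n : ℕ) :
    (x : Polynomial S).coeff n ∈ 𝔪 * I ^ n := by
  rw [Ideal.Quotient.eq_zero_iff_mem, Ideal.map] at h
  induction h using Submodule.span_induction generalizing n with
  | mem x hx =>
    obtain ⟨g, hg, rfl⟩ := hx
    have : ((algebraMap S (reesAlgebra I) g : reesAlgebra I) : Polynomial S) = Polynomial.C g := rfl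
    rw [this, Polynomial.coeff_C]
    split_ifs with hn
    · subst hn; simpa using hg
    · exact zero_mem _
  | zero => simp
  | add x y _ _ hx hy => simpa using add_mem (hx n) (hy n)
  | smul r x _ hx =>
    simp only [smul_eq_mul, Subalgebra.coe_mul, Polynomial.coeff_mul]
    refine sum_mem fun p hp => ?_
    have hp : p.1 + p.2 = n := Finset.HasAntidiagonal.mem_antidiagonal.1 hp
    have h1 := Ideal.mul_mem_mul (r.2 p.1) (hx p.2)
    rwa [mul_left_comm, ← pow_add, hp] at h1

lemma FiberCone.mk_eq_zero_of_monomial {𝔪 I : Ideal S} {n : ℕ} {g v : S} (hg : g ∈ 𝔪)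
    (hv : v ∈ I ^ n) {x : reesAlgebra I} (hx : (x : Polynomial S) = Polynomial.monomial n (g * v)) :
    (Ideal.Quotient.mk (𝔪.map (algebraMap S (reesAlgebra I)))) x = 0 := by
  have : x = algebraMap S (reesAlgebra I) g * ⟨Polynomial.monomial n v,
      reesAlgebra.monomial_mem.mpr hv⟩ := by
    ext1
    rw [hx, Subalgebra.coe_mul]
    change _ = Polynomial.C g * _
    rw [Polynomial.C_mul_monomial]
  rw [this, Ideal.Quotient.eq_zero_iff_mem]
  exact Ideal.mul_mem_right _ _ (Ideal.mem_map_of_mem _ hg)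

end FiberConeGeneral

section Presentation

variable (K : Type*) [Field K] (a b c : ℕ)

lemma symmGen_eq_monomial (k : Fin 4) :
    symmGen K a b c k = monomial (uExp a b c (Finsupp.single k 1)) 1 := by
  rw [monomial_eq, Finsupp.prod_fintype _ _ (by simp), Fin.prod_univ_two, uExp_zero, uExp_one]
  fin_cases k <;> simp [symmGen]

/-- The lift `z_k ↦ u_k t` of the presentation to the Rees algebra. -/
noncomputable def reesLift :
    MvPolynomial (Fin 4) K →ₐ[K] reesAlgebra (symmIdeal K a b c) :=
  aeval fun k => ⟨Polynomial.monomial 1 (symmGen K a b c k), reesAlgebra.monomial_mem.mpr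
    ((pow_one (symmIdeal K a b c)).symm ▸ Ideal.subset_span (Set.mem_range_self k))⟩

lemma presentation_apply (f : MvPolynomial (Fin 4) K) :
    presentation K a b c f = Ideal.Quotient.mk _ (reesLift K a b c f) := by
  have : presentation K a b c = (Ideal.Quotient.mkₐ K _).comp (reesLift K a b c) := by
    ext k
    simp [presentation, reesLift, FiberCone.degreeOne]
  rw [this]; rfl

lemma coe_reesLift_monomial (α : Fin 4 →₀ ℕ) (r : K) :
    (reesLift K a b c (monomial α r) : Polynomial (MvPolynomial (Fin 2) K)) =
      Polynomial.monomial α.degree (monomial (uExp a b c α) r) := by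
  have h0 : ∀ r : K, (reesLift K a b c (C r) : Polynomial (MvPolynomial (Fin 2) K)) =
      Polynomial.monomial 0 (C r) := fun r => by
    rw [← algebraMap_eq, AlgHom.commutes]; rfl
  have hX : ∀ k, (reesLift K a b c (X k) : Polynomial (MvPolynomial (Fin 2) K)) =
      Polynomial.monomial 1 (monomial (uExp a b c (Finsupp.single k 1)) 1) := fun k => by
    rw [← symmGen_eq_monomial, reesLift, aeval_X]
  induction α using Finsupp.induction_linear generalizing r with
  | zero =>
    have := h0 r
    rw [C_apply] at this
    rw [this]
    simp [uExp]
  | add α β hα hβ =>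
    have : monomial (α + β) r = monomial α r * monomial β (1 : K) := by
      rw [monomial_mul, mul_one]
    rw [this, map_mul, Subalgebra.coe_mul, hα, hβ, Polynomial.monomial_mul_monomial, monomial_mul,
      mul_one, uExp_add, map_add]
  | single k n =>
    have : monomial (Finsupp.single k n) r = C r * X k ^ n := by
      rw [X_pow_eq_monomial, C_mul_monomial, mul_one]
    rw [this, map_mul, map_pow, Subalgebra.coe_mul, Subalgebra.coe_pow, h0, hX,
      Polynomial.monomial_pow, Polynomial.monomial_mul_monomial, monomial_pow, C_mul_monomial]
    have hn : ∀ n : ℕ, uExp a b c (Finsupp.single k n) =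
        n • uExp a b c (Finsupp.single k 1) := fun n => by
      induction n with
      | zero => simp [uExp]
      | succ n ih => rw [Finsupp.single_add, uExp_add, ih, succ_nsmul]
    rw [hn n]
    simp

lemma monomial_uExp_mem_pow (α : Fin 4 →₀ ℕ) :
    monomial (uExp a b c α) (1 : K) ∈ symmIdeal K a b c ^ α.degree := by
  have := (reesLift K a b c (monomial α 1)).2 α.degree
  rwa [coe_reesLift_monomial, Polynomial.coeff_monomial, if_pos rfl] at this

variable {K a b c} in
lemma monomial_mem_definingIdeal {α : Fin 4 →₀ ℕ} (h : Dead a b c α) :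
    monomial α (1 : K) ∈ definingIdeal K a b c := by
  obtain ⟨β, hdeg, hlt⟩ := h
  rw [definingIdeal, RingHom.mem_ker]
  change presentation K a b c _ = 0
  rw [presentation_apply]
  refine FiberCone.mk_eq_zero_of_monomial (g := monomial (uExp a b c α - uExp a b c β) 1)
    ?_ (monomial_uExp_mem_pow K a b c β) ?_
  · have : ∃ k, 1 ≤ (uExp a b c α - uExp a b c β) k := by
      by_contra! hk
      refine hlt.not_ge fun k => ?_
      have := hk k
      simp only [Finsupp.coe_tsub, Pi.sub_apply] at this
      omega
    obtain ⟨k, hk⟩ := this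
    have hdvd : (X k : MvPolynomial (Fin 2) K) ∣
        monomial (uExp a b c α - uExp a b c β) (1 : K) := by
      rw [X, monomial_dvd_monomial]
      exact ⟨Or.inr (Finsupp.single_le_iff.2 hk), one_dvd _⟩
    refine Ideal.mem_of_dvd _ hdvd (Ideal.subset_span ?_)
    fin_cases k <;> simp
  · rw [coe_reesLift_monomial, monomial_mul, mul_one, tsub_add_cancel_of_le hlt.le, hdeg]

lemma sub_mem_definingIdeal {α β : Fin 4 →₀ ℕ} (h1 : α.degree = β.degree)
    (h2 : uExp a b c α = uExp a b c β) :
    monomial α (1 : K) - monomial β 1 ∈ definingIdeal K a b c := by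
  rw [definingIdeal, RingHom.mem_ker]
  change presentation K a b c _ = 0
  rw [presentation_apply]
  have : reesLift K a b c (monomial α (1 : K) - monomial β 1) = 0 := by
    ext1
    rw [map_sub, Subalgebra.coe_sub, coe_reesLift_monomial, coe_reesLift_monomial, h1, h2, sub_self]
    rfl
  rw [this, map_zero]

lemma symmIdeal_pow_le (n : ℕ) : symmIdeal K a b c ^ n ≤
    Ideal.span ((fun s => monomial s (1 : K)) ''
      {ξ | ∃ β : Fin 4 →₀ ℕ, β.degree = n ∧ ξ = uExp a b c β}) := by
  induction n with
  | zero =>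
    rw [pow_zero, Ideal.one_eq_top, top_le_iff, Ideal.eq_top_iff_one]
    exact Ideal.subset_span ⟨0, ⟨0, by simp, by simp [uExp]⟩, rfl⟩
  | succ n ih =>
    rw [pow_succ]
    refine (Ideal.mul_mono_left ih).trans ?_
    rw [symmIdeal, Ideal.span_mul_span', Ideal.span_le]
    rintro _ ⟨_, ⟨_, ⟨β, hβ, rfl⟩, rfl⟩, _, ⟨k, rfl⟩, rfl⟩
    have : (monomial (uExp a b c β) (1 : K)) * symmGen K a b c k =
        monomial (uExp a b c (β + Finsupp.single k 1)) 1 := by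
      rw [symmGen_eq_monomial, monomial_mul, mul_one, uExp_add]
    have hmem : uExp a b c (β + Finsupp.single k 1) ∈
        {ξ | ∃ β : Fin 4 →₀ ℕ, β.degree = n + 1 ∧ ξ = uExp a b c β} :=
      ⟨β + Finsupp.single k 1, by simp [hβ], rfl⟩
    exact Set.mem_of_eq_of_mem this (Ideal.subset_span (Set.mem_image_of_mem _ hmem))

lemma exists_lt_of_mem_maxIdeal_mul_pow {n : ℕ} {g : MvPolynomial (Fin 2) K}
    (hg : g ∈ maxIdeal K * symmIdeal K a b c ^ n) {ξ : Fin 2 →₀ ℕ} (hξ : coeff ξ g ≠ 0) :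
    ∃ β : Fin 4 →₀ ℕ, β.degree = n ∧ uExp a b c β < ξ := by
  have hle : maxIdeal K * symmIdeal K a b c ^ n ≤
      Ideal.span ((fun s => monomial s (1 : K)) ''
        {ξ | ∃ β : Fin 4 →₀ ℕ, β.degree = n ∧ uExp a b c β < ξ}) := by
    refine (Ideal.mul_mono_right (symmIdeal_pow_le K a b c n)).trans ?_
    rw [maxIdeal, Ideal.span_mul_span', Ideal.span_le]
    rintro _ ⟨v, hv, _, ⟨_, ⟨β, hβ, rfl⟩, rfl⟩, rfl⟩
    obtain ⟨k, rfl⟩ : ∃ k, v = X k := by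
      rcases hv with rfl | rfl
      · exact ⟨0, rfl⟩
      · exact ⟨1, rfl⟩
    refine Ideal.subset_span ⟨Finsupp.single k 1 + uExp a b c β, ⟨β, hβ, ?_⟩, ?_⟩
    · exact lt_add_of_pos_left _ (pos_iff_ne_zero.2 (by simp))
    · simp [X, monomial_mul]
  obtain ⟨η, ⟨β, h1, h2⟩, h3⟩ := mem_ideal_span_monomial_image.1 (hle hg) ξ (mem_support_iff.2 hξ)
  exact ⟨β, h1, h2.trans_le h3⟩

/-- The live products of generators are linearly independent in the fiber cone: if `f` is in the
defining ideal, then its coefficients along the monomials with the same live product add up to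
zero. -/
lemma sum_coeff_eq_zero_of_mem {f : MvPolynomial (Fin 4) K} (hf : f ∈ definingIdeal K a b c)
    {α : Fin 4 →₀ ℕ} (hα : ¬ Dead a b c α) :
    ∑ β ∈ f.support with β.degree = α.degree ∧ uExp a b c β = uExp a b c α, coeff β f = 0 := by
  classical
  rw [definingIdeal, RingHom.mem_ker] at hf
  change presentation K a b c _ = 0 at hf
  rw [presentation_apply] at hf
  have h1 := FiberCone.coeff_mem_of_mk_eq_zero hf α.degree
  have h2 : coeff (uExp a b c α)
      ((reesLift K a b c f : Polynomial (MvPolynomial (Fin 2) K)).coeff α.degree) =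
      ∑ β ∈ f.support with β.degree = α.degree ∧ uExp a b c β = uExp a b c α, coeff β f := by
    conv_lhs => rw [f.as_sum]
    rw [map_sum (reesLift K a b c), AddSubmonoidClass.coe_finsetSum, Polynomial.finsetSum_coeff,
      coeff_sum,
      Finset.sum_filter]
    refine Finset.sum_congr rfl fun β _ => ?_
    rw [coe_reesLift_monomial, Polynomial.coeff_monomial]
    by_cases hdeg : β.degree = α.degree
    · simp [hdeg, coeff_monomial]
    · simp [hdeg]
  rw [← h2]
  by_contra hne
  obtain ⟨β, h3, h4⟩ := exists_lt_of_mem_maxIdeal_mul_pow K a b c h1 hne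
  exact hα ⟨β, h3, h4⟩

lemma presentation_X (k : Fin 4) : presentation K a b c (X k) =
    FiberCone.degreeOne (maxIdeal K) (symmIdeal K a b c) (symmGen K a b c k)
      (Ideal.subset_span (Set.mem_range_self k)) :=
  aeval_X _ k

lemma presentation_surjective : Function.Surjective (presentation K a b c) := by
  set q := Ideal.Quotient.mk ((maxIdeal K).map
    (algebraMap (MvPolynomial (Fin 2) K) (reesAlgebra (symmIdeal K a b c))))
    with hq
  have hS : ∀ s : MvPolynomial (Fin 2) K, ∃ f, presentation K a b c f =
      q (algebraMap (MvPolynomial (Fin 2) K) (reesAlgebra (symmIdeal K a b c)) s) := by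
    intro s
    induction s using MvPolynomial.induction_on with
    | C r =>
      refine ⟨C r, ?_⟩
      rw [← algebraMap_eq, AlgHom.commutes]; rfl
    | add f g hf hg =>
      obtain ⟨f', hf⟩ := hf
      obtain ⟨g', hg⟩ := hg
      exact ⟨f' + g', by rw [map_add, map_add, map_add, hf, hg]⟩
    | mul_X f k _ =>
      refine ⟨0, ?_⟩
      rw [map_zero, map_mul, map_mul]
      have : q (algebraMap (MvPolynomial (Fin 2) K) (reesAlgebra (symmIdeal K a b c)) (X k)) =
          0 := by
        rw [Ideal.Quotient.eq_zero_iff_mem]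
        refine Ideal.mem_map_of_mem _ (Ideal.subset_span ?_)
        fin_cases k <;> simp
      rw [this, mul_zero]
  have hI : ∀ (u) (hu : u ∈ symmIdeal K a b c), ∃ f, presentation K a b c f =
      FiberCone.degreeOne (maxIdeal K) (symmIdeal K a b c) u hu := by
    intro u hu
    obtain ⟨t, ht⟩ := Ideal.mem_span_range_iff_exists_fun.1 hu
    choose f hf using hS
    refine ⟨∑ k, f (t k) * X k, ?_⟩
    rw [map_sum (presentation K a b c)]
    have : ∀ k, presentation K a b c (f (t k) * X k) =
        q (algebraMap (MvPolynomial (Fin 2) K) (reesAlgebra (symmIdeal K a b c)) (t k) *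
          (⟨Polynomial.monomial 1 (symmGen K a b c k), reesAlgebra.monomial_mem.mpr
            ((pow_one (symmIdeal K a b c)).symm ▸ Ideal.subset_span (Set.mem_range_self k))⟩ :
              reesAlgebra (symmIdeal K a b c))) := by
      intro k
      rw [map_mul, hf, presentation_X, map_mul]
      rfl
    rw [Finset.sum_congr rfl fun k _ => this k, ← map_sum q]
    refine congrArg q (Subtype.ext ?_)
    rw [AddSubmonoidClass.coe_finsetSum]
    subst ht
    change _ = Polynomial.monomial 1 (∑ k, t k * symmGen K a b c k)
    rw [map_sum]
    refine Finset.sum_congr rfl fun k _ => ?_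
    rw [Subalgebra.coe_mul]
    change Polynomial.C _ * Polynomial.monomial 1 _ = _
    rw [Polynomial.C_mul_monomial]
  have key : ∀ (p : Polynomial (MvPolynomial (Fin 2) K)) (hp : p ∈ reesAlgebra (symmIdeal K a b c)),
      ∃ f, presentation K a b c f = q ⟨p, hp⟩ := by
    intro p hp
    have hp' := hp
    rw [← adjoin_monomial_eq_reesAlgebra] at hp'
    induction hp' using Algebra.adjoin_induction with
    | mem p hp' =>
      obtain ⟨u, hu, rfl⟩ := hp'
      exact hI u hu
    | algebraMap s => exact hS s
    | add x y hx hy ihx ihy =>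
      rw [adjoin_monomial_eq_reesAlgebra] at hx hy
      obtain ⟨f, hf⟩ := ihx hx
      obtain ⟨g, hg⟩ := ihy hy
      exact ⟨f + g, by rw [map_add, hf, hg, ← map_add]; rfl⟩
    | mul x y hx hy ihx ihy =>
      rw [adjoin_monomial_eq_reesAlgebra] at hx hy
      obtain ⟨f, hf⟩ := ihx hx
      obtain ⟨g, hg⟩ := ihy hy
      exact ⟨f * g, by rw [map_mul, hf, hg, ← map_mul]; rfl⟩
  intro y
  obtain ⟨x, rfl⟩ := Ideal.Quotient.mk_surjective y
  exact key x.1 x.2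

lemma presentation_X_mem_irrelevant (k : Fin 4) :
    presentation K a b c (X k) ∈ FiberCone.irrelevant (maxIdeal K) (symmIdeal K a b c) := by
  rw [presentation_X]
  refine Ideal.mem_map_of_mem _ ?_
  rw [RingHom.mem_ker]
  exact Polynomial.coeff_monomial_of_ne _ (by simp)

/-- Members of the irrelevant ideal lift to polynomials without constant term. -/
lemma mem_irrelevant_iff {x : FiberCone (maxIdeal K) (symmIdeal K a b c)} :
    x ∈ FiberCone.irrelevant (maxIdeal K) (symmIdeal K a b c) ↔
      ∃ f ∈ Ideal.span (Set.range (X : Fin 4 → MvPolynomial (Fin 4) K)),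
        presentation K a b c f = x := by
  constructor
  · intro hx
    rw [FiberCone.irrelevant, Ideal.mem_map_iff_of_surjective _ Ideal.Quotient.mk_surjective] at hx
    obtain ⟨y, hy, rfl⟩ := hx
    obtain ⟨f, hf⟩ := presentation_surjective K a b c (Ideal.Quotient.mk _ y)
    refine ⟨f, ?_, hf⟩
    rw [presentation_apply, ← sub_eq_zero, ← map_sub] at hf
    have h0 := FiberCone.coeff_mem_of_mk_eq_zero hf 0
    have hy0 : (y : Polynomial (MvPolynomial (Fin 2) K)).coeff 0 = 0 := by
      rw [RingHom.mem_ker] at hy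
      exact hy
    rw [Subalgebra.coe_sub, Polynomial.coeff_sub, hy0, sub_zero] at h0
    have hhom : (constantCoeff.comp ((Polynomial.constantCoeff.comp
        (reesAlgebra (symmIdeal K a b c)).val.toRingHom).comp (reesLift K a b c).toRingHom)) =
        (constantCoeff : MvPolynomial (Fin 4) K →+* K) := by
      refine MvPolynomial.ringHom_ext (fun r => ?_) fun k => ?_
      · have : reesLift K a b c (C r) = algebraMap K _ r := by
          rw [← algebraMap_eq, AlgHom.commutes]
        change constantCoeff ((reesLift K a b c (C r)).1.coeff 0) = _
        rw [this]
        change constantCoeff ((Polynomial.C (C r : MvPolynomial (Fin 2) K)).coeff 0) = _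
        simp
      · change constantCoeff ((reesLift K a b c (X k)).1.coeff 0) = _
        rw [reesLift, aeval_X]
        change constantCoeff ((Polynomial.monomial 1 _).coeff 0) = _
        rw [Polynomial.coeff_monomial_of_ne _ (by simp)]
        simp
    have hf0 : constantCoeff f = 0 := by
      rw [← hhom]
      have hle : maxIdeal K ≤ RingHom.ker (constantCoeff : MvPolynomial (Fin 2) K →+* K) := by
        rw [maxIdeal, Ideal.span_le]
        rintro _ (rfl | rfl) <;> simp
      exact hle (by simpa using h0)
    rw [← Set.image_univ, mem_ideal_span_X_image]
    intro α hα
    by_contra! hne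
    have : α = 0 := Finsupp.ext fun k => hne k trivial
    subst this
    exact mem_support_iff.1 hα hf0
  · rintro ⟨f, hf, rfl⟩
    have hle : Ideal.span (Set.range (X : Fin 4 → MvPolynomial (Fin 4) K)) ≤
        (FiberCone.irrelevant (maxIdeal K) (symmIdeal K a b c)).comap (presentation K a b c) := by
      rw [Ideal.span_le]
      rintro _ ⟨k, rfl⟩
      exact presentation_X_mem_irrelevant K a b c k
    exact hle hf

end Presentation

section

/-! ### Which monomials are dead -/

/-- The exponent of `z₁ ^ p * z₂ ^ q * z₃ ^ r * z₄ ^ s`. -/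
noncomputable def ex (p q r s : ℕ) : Fin 4 →₀ ℕ := Finsupp.equivFunOnFinite.symm ![p, q, r, s]

section ex

variable (p q r s p' q' r' s' : ℕ)

@[simp] lemma ex_apply_zero : ex p q r s 0 = p := rfl
@[simp] lemma ex_apply_one : ex p q r s 1 = q := rfl
@[simp] lemma ex_apply_two : ex p q r s 2 = r := rfl
@[simp] lemma ex_apply_three : ex p q r s 3 = s := rfl

variable {p q r s p' q' r' s'}

lemma ex_ext {α β : Fin 4 →₀ ℕ} (h0 : α 0 = β 0) (h1 : α 1 = β 1) (h2 : α 2 = β 2)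
    (h3 : α 3 = β 3) : α = β := by
  ext k; fin_cases k <;> assumption

lemma le_iff_fin_four {α β : Fin 4 →₀ ℕ} :
    α ≤ β ↔ α 0 ≤ β 0 ∧ α 1 ≤ β 1 ∧ α 2 ≤ β 2 ∧ α 3 ≤ β 3 := by
  rw [Finsupp.le_def, Fin.forall_fin_succ, Fin.forall_fin_succ, Fin.forall_fin_succ,
    Fin.forall_fin_one]
  rfl

lemma ex_add : ex p q r s + ex p' q' r' s' = ex (p + p') (q + q') (r + r') (s + s') :=
  ex_ext (by simp) (by simp) (by simp) (by simp)

lemma exists_ex (α : Fin 4 →₀ ℕ) : ∃ p q r s, α = ex p q r s :=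
  ⟨α 0, α 1, α 2, α 3, ex_ext rfl rfl rfl rfl⟩

lemma monomial_ex (K : Type*) [Field K] : monomial (ex p q r s) (1 : K) =
    X 0 ^ p * X 1 ^ q * X 2 ^ r * X 3 ^ s := by
  rw [monomial_eq, Finsupp.prod_fintype _ _ (by simp), Fin.prod_univ_four]
  simp

end ex

variable {a b c : ℕ}

lemma uExp_lt_iff {α β : Fin 4 →₀ ℕ} : uExp a b c β < uExp a b c α ↔
    c * β 0 + b * β 1 + a * β 2 ≤ c * α 0 + b * α 1 + a * α 2 ∧
    a * β 1 + b * β 2 + c * β 3 ≤ a * α 1 + b * α 2 + c * α 3 ∧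
    (c * β 0 + b * β 1 + a * β 2) + (a * β 1 + b * β 2 + c * β 3) <
      (c * α 0 + b * α 1 + a * α 2) + (a * α 1 + b * α 2 + c * α 3) := by
  rw [lt_iff_le_not_ge, Finsupp.le_def, Finsupp.le_def, Fin.forall_fin_two, Fin.forall_fin_two]
  simp only [uExp_zero, uExp_one]
  omega

lemma uExp_eq_iff {α β : Fin 4 →₀ ℕ} : uExp a b c α = uExp a b c β ↔
    c * α 0 + b * α 1 + a * α 2 = c * β 0 + b * β 1 + a * β 2 ∧
    a * α 1 + b * α 2 + c * α 3 = a * β 1 + b * β 2 + c * β 3 := by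
  rw [Finsupp.ext_iff, Fin.forall_fin_two]
  simp only [uExp_zero, uExp_one]

lemma dead_ex_reverse {p q r s : ℕ} (h : Dead a b c (ex p q r s)) : Dead a b c (ex s r q p) := by
  obtain ⟨β, h1, h2⟩ := h
  refine ⟨ex (β 3) (β 2) (β 1) (β 0), ?_, ?_⟩
  · simp only [degree_fin_four, ex_apply_zero, ex_apply_one, ex_apply_two, ex_apply_three] at h1 ⊢
    omega
  · rw [uExp_lt_iff] at h2 ⊢
    simp only [ex_apply_zero, ex_apply_one, ex_apply_two, ex_apply_three] at h2 ⊢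
    omega

/-- The monomial `z₁ ^ p * z₃ ^ r` is dead; by symmetry this is the same as `z₂ ^ r * z₄ ^ p`
being dead. -/
def DeadPair (a b c p r : ℕ) : Prop := Dead a b c (ex p 0 r 0)

lemma DeadPair.mono {p r p' r' : ℕ} (h : DeadPair a b c p r) (hp : p ≤ p') (hr : r ≤ r') :
    DeadPair a b c p' r' :=
  Dead.mono h (le_iff_fin_four.2 ⟨hp, le_rfl, hr, le_rfl⟩)

/-- The product `u₁ ^ p * u₃ ^ r` is strictly divisible by `u₂ ^ (p + r - s) * u₄ ^ s`
for some `s < p`; with `r = r₀ + s`, the inequalities compare the exponents of `y` and of `x`. -/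
def Dominated (a b c p r : ℕ) : Prop :=
  ∃ s r₀, s < p ∧ r = r₀ + s ∧ a * p + (c - b) * s ≤ (b - a) * r₀ ∧
    (b - a) * r₀ ≤ (c - b) * p + a * s

lemma Admissible.exists_eq (h : Admissible a b c) :
    ∃ d k, 0 < a ∧ 0 < d ∧ 0 < k ∧ b = a + d ∧ c = 2 * a + d + k ∧ b - a = d ∧ c - b = a + k := by
  obtain ⟨h1, h2, h3, _, h5⟩ := h
  exact ⟨b - a, c - a - b, h1, by omega, by omega, by omega, by omega, rfl, by omega⟩

lemma dead_of_pos (h : Admissible a b c) {α : Fin 4 →₀ ℕ} (h0 : 0 < α 0) (h3 : 0 < α 3) :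
    Dead a b c α := by
  have : Dead a b c (ex 1 0 0 1) := by
    refine ⟨ex 0 1 1 0, by simp [degree_fin_four], ?_⟩
    rw [uExp_lt_iff]
    obtain ⟨_, _, _, _, h5⟩ := h
    simp only [ex_apply_zero, ex_apply_one, ex_apply_two, ex_apply_three]
    omega
  exact this.mono (le_iff_fin_four.2 ⟨h0, by simp, by simp, h3⟩)

lemma Dominated.deadPair (h : Admissible a b c) {p r : ℕ} (hd : Dominated a b c p r) :
    DeadPair a b c p r := by
  obtain ⟨s, r₀, hs, rfl, h1, h2⟩ := hd
  obtain ⟨d, k, ha, hd, hk, rfl, rfl, hd', hk'⟩ := h.exists_eq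
  rw [hd', hk'] at h1 h2
  refine ⟨ex 0 (p + r₀) 0 s, by simp [degree_fin_four]; omega, ?_⟩
  obtain ⟨t, rfl⟩ := Nat.exists_eq_add_of_lt hs
  rw [uExp_lt_iff]
  simp only [ex_apply_zero, ex_apply_one, ex_apply_two, ex_apply_three]
  refine ⟨by nlinarith, by nlinarith, by nlinarith⟩

/-- A dead monomial `z₁ ^ p * z₂ ^ q * z₃ ^ r` is a multiple of a dominated monomial in `z₁`, `z₃`.
The weights `(1, 1)` and `(a, c - b)` of `(x, y)`, each minimal along an edge of the Newton polygon
of `I`, show that a divisor involves less of `z₁` and of `z₃`; after cancellation it involves only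
`z₂` and `z₄`. -/
lemma exists_dominated_of_dead (h : Admissible a b c) {p q r : ℕ}
    (hd : Dead a b c (ex p q r 0)) : ∃ p' r', p' ≤ p ∧ r' ≤ r ∧ Dominated a b c p' r' := by
  obtain ⟨β, h1, h2⟩ := hd
  obtain ⟨p', q', r', s, rfl⟩ := exists_ex β
  obtain ⟨d, k, ha, hd, hk, rfl, rfl, hd', hk'⟩ := h.exists_eq
  rw [uExp_lt_iff] at h2
  simp only [degree_fin_four, ex_apply_zero, ex_apply_one, ex_apply_two, ex_apply_three,
    mul_zero, add_zero] at h1 h2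
  obtain ⟨hX, hY, hXY⟩ := h2
  -- the weight `(1, 1)`
  have w1 : p' + s < p := by
    by_contra! hle
    nlinarith
  -- the weight `(a, c - b)`
  have w2 : r' < r := by
    by_contra! hle
    have e1 : (a * (2 * a + d + k)) * (p' + q' + r' + s) = (a * (2 * a + d + k)) * (p + q + r) := by
      rw [h1]
    have e2 := Nat.mul_lt_mul_of_pos_left hXY ha
    have e3 := Nat.mul_le_mul_left k hY
    have e4 := Nat.mul_le_mul_left (k * d) hle
    have e5 : 0 ≤ k * (2 * a + d + k) * s := Nat.zero_le _
    nlinarith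
  obtain ⟨P, rfl⟩ := Nat.exists_eq_add_of_le (show p' ≤ p by omega)
  obtain ⟨R, rfl⟩ := Nat.exists_eq_add_of_le w2.le
  obtain ⟨t, rfl⟩ := Nat.exists_eq_add_of_lt (show s < P by omega)
  obtain rfl : q' = t + 1 + R + q := by omega
  have hR : s ≤ R := by
    by_contra! hlt
    nlinarith [Nat.mul_le_mul_left d hlt.le]
  obtain ⟨r₀, rfl⟩ := Nat.exists_eq_add_of_le' hR
  refine ⟨s + t + 1, r₀ + s, by omega, by omega, s, r₀, by omega, rfl, ?_, ?_⟩
  · rw [hd', hk']; nlinarith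
  · rw [hd', hk']; nlinarith

lemma deadPair_iff (h : Admissible a b c) {p r : ℕ} :
    DeadPair a b c p r ↔ ∃ p' r', p' ≤ p ∧ r' ≤ r ∧ Dominated a b c p' r' :=
  ⟨exists_dominated_of_dead h, fun ⟨_, _, h1, h2, h3⟩ => (h3.deadPair h).mono h1 h2⟩

lemma dead_iff (h : Admissible a b c) {α : Fin 4 →₀ ℕ} : Dead a b c α ↔
    (0 < α 0 ∧ 0 < α 3) ∨ DeadPair a b c (α 0) (α 2) ∨ DeadPair a b c (α 3) (α 1) := by
  obtain ⟨p, q, r, s, rfl⟩ := exists_ex α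
  simp only [ex_apply_zero, ex_apply_one, ex_apply_two, ex_apply_three]
  constructor
  · intro hd
    by_cases hps : 0 < p ∧ 0 < s
    · exact Or.inl hps
    · right
      obtain rfl | rfl : s = 0 ∨ p = 0 := by omega
      · exact Or.inl ((deadPair_iff h).2 (exists_dominated_of_dead h hd))
      · exact Or.inr ((deadPair_iff h).2 (exists_dominated_of_dead h (dead_ex_reverse hd)))
  · rintro (hd | hd | hd)
    · exact dead_of_pos h hd.1 hd.2
    · exact Dead.mono hd (le_iff_fin_four.2 ⟨le_rfl, by simp, le_rfl, by simp⟩)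
    · exact Dead.mono (dead_ex_reverse hd) (le_iff_fin_four.2 ⟨by simp, le_rfl, by simp, le_rfl⟩)

/-! ### The poset `S` -/

lemma mem_posetS_iff (h : Admissible a b c) {i j : ℕ} : (i, j) ∈ posetS a b c ↔
    0 < i ∧ 0 < j ∧ a * i ≤ (b - a) * j ∧ (b - a) * j ≤ (c - b) * i := by
  obtain ⟨d, k, ha, hd, hk, rfl, rfl, hd', hk'⟩ := h.exists_eq
  rw [hd', hk']
  simp only [posetS, Set.mem_ofPred_eq]
  have e1 : ((2 * a + d + k : ℕ) : ℚ) - ((a + d : ℕ) : ℚ) = ((a + k : ℕ) : ℚ) := by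
    push_cast; ring
  have e2 : ((a + d : ℕ) : ℚ) - (a : ℚ) = d := by push_cast; ring
  have ha' : (0 : ℚ) < a := by exact_mod_cast ha
  have hk' : (0 : ℚ) < ((a + k : ℕ) : ℚ) := by exact_mod_cast (by omega : 0 < a + k)
  rw [e1, e2, div_mul_eq_mul_div, div_mul_eq_mul_div, div_le_iff₀ hk', le_div_iff₀ ha']
  rw [mul_comm (i : ℚ), mul_comm (i : ℚ)]
  norm_cast
  tauto

/-- `S` is nonempty and closed under componentwise minima. -/
lemma exists_isLeast_posetS (h : Admissible a b c) :
    ∃ i j, IsLeast (posetS a b c) (i, j) := by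
  classical
  have hne : ∃ i j, (i, j) ∈ posetS a b c := by
    refine ⟨b - a, a, (mem_posetS_iff h).2 ⟨?_, h.1, (mul_comm _ _).le, ?_⟩⟩
    · have := h.2.1; omega
    · rw [mul_comm]
      exact Nat.mul_le_mul_right _ (by have := h.2.2.2.2; omega)
  have hne' : ∃ j i, (i, j) ∈ posetS a b c := by
    obtain ⟨i, j, hij⟩ := hne; exact ⟨j, i, hij⟩
  obtain ⟨j, hj⟩ := Nat.find_spec hne
  obtain ⟨i, hi⟩ := Nat.find_spec hne'
  have hij : Nat.find hne ≤ i := Nat.find_min' hne ⟨_, hi⟩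
  have hji : Nat.find hne' ≤ j := Nat.find_min' hne' ⟨_, hj⟩
  refine ⟨Nat.find hne, Nat.find hne', ?_, ?_⟩
  · rw [mem_posetS_iff h] at hi hj ⊢
    exact ⟨hj.1, hi.2.1, (Nat.mul_le_mul_left _ hij).trans hi.2.2.1,
      (Nat.mul_le_mul_left _ hji).trans hj.2.2.2⟩
  · rintro ⟨p, r⟩ hp
    exact ⟨Nat.find_min' hne ⟨_, hp⟩, Nat.find_min' hne' ⟨_, hp⟩⟩

/-- A domination by `z₂ ^ (r₀ + p) * z₄ ^ s` yields the point `(p + s, r₀)` of `S`, because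
`a ≤ c - b`. -/
lemma Dominated.exists_mem_posetS (h : Admissible a b c) {p r : ℕ} (hd : Dominated a b c p r) :
    ∃ s r₀, s < p ∧ r = r₀ + s ∧ (p + s, r₀) ∈ posetS a b c := by
  obtain ⟨s, r₀, hs, hr, h1, h2⟩ := hd
  refine ⟨s, r₀, hs, hr, (mem_posetS_iff h).2 ⟨by omega, ?_, ?_, ?_⟩⟩
  · refine Nat.pos_of_ne_zero fun h0 => ?_
    subst h0
    have := Nat.mul_pos h.1 (show 0 < p by omega)
    simp only [mul_zero] at h1
    omega
  · refine le_trans ?_ h1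
    rw [mul_add]
    exact Nat.add_le_add_left (Nat.mul_le_mul_right _ (by have := h.2.2.2.2; omega)) _
  · refine h2.trans ?_
    rw [mul_add]
    exact Nat.add_le_add_left (Nat.mul_le_mul_right _ (by have := h.2.2.2.2; omega)) _

lemma deadPair_of_mem_posetS (h : Admissible a b c) {i j : ℕ} (hij : (i, j) ∈ posetS a b c) :
    DeadPair a b c i j := by
  rw [mem_posetS_iff h] at hij
  exact Dominated.deadPair h ⟨0, j, hij.1, rfl, by simpa using hij.2.2.1, by simpa using hij.2.2.2⟩

lemma Dominated.le_of_isLeast (h : Admissible a b c) {i j p r : ℕ}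
    (hl : IsLeast (posetS a b c) (i, j)) (hd : Dominated a b c p r) :
    0 < p ∧ j ≤ r ∧ (r = j → i ≤ p) := by
  obtain ⟨s, r₀, hs, rfl, hS⟩ := hd.exists_mem_posetS h
  have := hl.2 hS
  have h1 : i ≤ p + s := this.1
  have h2 : j ≤ r₀ := this.2
  omega

lemma DeadPair.le_of_isLeast (h : Admissible a b c) {i j p r : ℕ}
    (hl : IsLeast (posetS a b c) (i, j)) (hd : DeadPair a b c p r) :
    0 < p ∧ j ≤ r ∧ (r = j → i ≤ p) := by
  obtain ⟨p', r', hp, hr, hd⟩ := (deadPair_iff h).1 hd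
  have := hd.le_of_isLeast h hl
  omega

/-! ### The exponents of the binomial -/

lemma Admissible.exists_ell (h : Admissible a b c) : ∃ g ℓ m k, 0 < g ∧ 0 < ℓ ∧ 0 < k ∧
    m = k + ℓ ∧ Nat.Coprime ℓ m ∧ b - a = g * ℓ ∧ c = g * m ∧ a + (c - b) = g * k ∧
    (b - a) / Nat.gcd c (b - a) = ℓ ∧ c / Nat.gcd c (b - a) = m := by
  have hd : 0 < b - a := by have := h.2.1; omega
  have hc : 0 < c := by have := h.2.2.1; omega
  set g := Nat.gcd c (b - a) with hg
  have hgpos : 0 < g := Nat.gcd_pos_of_pos_left _ hc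
  obtain ⟨m, hm⟩ : g ∣ c := Nat.gcd_dvd_left _ _
  obtain ⟨ℓ, hℓ⟩ : g ∣ b - a := Nat.gcd_dvd_right _ _
  have hlt : ℓ < m := by
    by_contra! hle
    have := Nat.mul_le_mul_left g hle
    have := h.1
    have := h.2.2.1
    omega
  refine ⟨g, ℓ, m, m - ℓ, hgpos, ?_, by omega, by omega, ?_, hℓ, hm, ?_, ?_, ?_⟩
  · exact Nat.pos_of_ne_zero fun h0 => by subst h0; omega
  · have := Nat.coprime_div_gcd_div_gcd (m := c) (n := b - a) hgpos
    rw [← hg, hm, hℓ, Nat.mul_div_cancel_left _ hgpos, Nat.mul_div_cancel_left _ hgpos] at this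
    exact this.symm
  · rw [Nat.mul_sub, ← hm, ← hℓ]
    have := h.2.1
    have := h.2.2.1
    omega
  · rw [hℓ, Nat.mul_div_cancel_left _ hgpos]
  · rw [← Nat.mul_div_cancel_left m hgpos, ← hm]

variable (a b c) in
/-- The exponent `ℓ` of the binomial. -/
def ell : ℕ := (b - a) / Nat.gcd c (b - a)

variable (a b c) in
/-- The exponent `m` of the binomial. -/
def emm : ℕ := c / Nat.gcd c (b - a)

lemma ell_pos (h : Admissible a b c) : 0 < ell a b c := by
  obtain ⟨g, ℓ, m, k, _, hℓ, _, _, _, _, _, _, h1, _⟩ := h.exists_ell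
  rwa [ell, h1]

/-- The point `(2ℓ, m - ℓ)` lies in `S`, on the line through the middle of the cone. -/
lemma lt_emm_of_isLeast (h : Admissible a b c) {i j : ℕ} (hl : IsLeast (posetS a b c) (i, j)) :
    j < emm a b c := by
  obtain ⟨g, ℓ, m, k, hg, hℓ, hk, hm, _, hd, hc, hk', h1, h2⟩ := h.exists_ell
  have hae : a ≤ c - b := by have := h.2.2.2.2; omega
  have : (2 * ℓ, k) ∈ posetS a b c := by
    have e : (b - a) * k = (a + (c - b)) * ℓ := by rw [hd, hk']; ring
    refine (mem_posetS_iff h).2 ⟨by omega, hk, ?_, ?_⟩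
    · rw [e]; nlinarith
    · rw [e]; nlinarith
  have : j ≤ k := (hl.2 this).2
  rw [emm, h2]
  omega

/-- Multiplication by `z₃` does not kill `z₁ ^ ℓ * z₃ ^ m` if it is alive: a dominated monomial lies
strictly on one side of the line through `(ℓ, m)`. -/
lemma deadPair_ell_emm_of_add (h : Admissible a b c) {r : ℕ} (hr : DeadPair a b c (ell a b c) r) :
    DeadPair a b c (ell a b c) (emm a b c) := by
  obtain ⟨g, ℓ, m, k, hg, hℓ, hk, hm, _, hd, hc, hk', h1, h2⟩ := h.exists_ell
  change ell a b c = ℓ at h1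
  change emm a b c = m at h2
  rw [h1] at hr
  rw [h1, h2]
  obtain ⟨p', r', hp, hr, hdom⟩ := (deadPair_iff h).1 hr
  refine (deadPair_iff h).2 ⟨p', r', hp, ?_, hdom⟩
  obtain ⟨s, r₀, hs, rfl, h3, h4⟩ := hdom
  have hb : b = a + (b - a) := by have := h.2.1; omega
  have hce : c = a + (b - a) + (c - b) := by have := h.2.2.1; omega
  have h5 : (b - a) * (r₀ + s) < c * p' := by
    have hbpos : 0 < a + (b - a) := by have := h.1; omega
    have := Nat.mul_lt_mul_of_pos_left hs hbpos
    calc (b - a) * (r₀ + s) ≤ (c - b) * p' + (a + (b - a)) * s := by nlinarith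
      _ < (c - b) * p' + (a + (b - a)) * p' := by omega
      _ = (a + (b - a) + (c - b)) * p' := by ring
      _ = c * p' := by rw [← hce]
  rw [hd, hc] at h5
  have h6 : g * ℓ * (r₀ + s) < g * ℓ * m := by
    calc _ < g * m * p' := h5
      _ ≤ g * m * ℓ := Nat.mul_le_mul_left _ hp
      _ = g * ℓ * m := by ring
  exact (Nat.lt_of_mul_lt_mul_left h6).le

/-- The lattice of relations among the products of generators is generated by `(ℓ, -m, m, -ℓ)`; for
a live product, the twofold multiple of this vector cannot occur. -/
lemma eq_of_uExp_eq (h : Admissible a b c) {α β : Fin 4 →₀ ℕ} (hdeg : α.degree = β.degree)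
    (hu : uExp a b c α = uExp a b c β) (hα : ¬ Dead a b c α) (hle : β 0 < α 0 ∨ β 0 = α 0) :
    α = β ∨ ∃ q r, α = ex (ell a b c) q (emm a b c + r) 0 ∧
      β = ex 0 (emm a b c + q) r (ell a b c) := by
  have hβ : ¬ Dead a b c β := by rwa [← dead_congr hdeg hu]
  have hα0 : ∀ γ : Fin 4 →₀ ℕ, γ.degree = α.degree → uExp a b c γ = uExp a b c α →
      ¬ (0 < γ 0 ∧ 0 < γ 3) := fun γ h1 h2 h3 =>
    hα ((dead_congr h1 h2).1 (dead_of_pos h h3.1 h3.2))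
  obtain ⟨g, ℓ, m, k, hg, hℓ, hk, hm, hco, hd, hc, hk', h1, h2⟩ := h.exists_ell
  rw [ell, emm, h1, h2]
  have hb : b = a + g * ℓ := by have := h.2.1; omega
  obtain ⟨p, q, r, s, rfl⟩ := exists_ex α
  obtain ⟨p', q', r', s', rfl⟩ := exists_ex β
  have hu' := uExp_eq_iff.1 hu
  simp only [degree_fin_four, ex_apply_zero, ex_apply_one, ex_apply_two, ex_apply_three]
    at hdeg hu' hle hα0
  have hh : a + b < c := h.2.2.2.2
  -- compare the total degrees in `x`, `y`
  have hps : p + s = p' + s' := by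
    zify at *
    have : ((c : ℤ) - a - b) * (p + s - p' - s') = 0 := by
      linear_combination hu'.1 + hu'.2 - (a + b) * hdeg
    rcases mul_eq_zero.1 this with h0 | h0 <;> linarith
  obtain ⟨v, rfl⟩ := Nat.exists_eq_add_of_le (show p' ≤ p by omega)
  obtain rfl : s' = s + v := by omega
  have hvm : (m : ℤ) * v = ℓ * (r - r') := by
    have hg' : (g : ℤ) ≠ 0 := by exact_mod_cast hg.ne'
    apply mul_left_cancel₀ hg'
    have hb' : (b : ℤ) = a + g * ℓ := by exact_mod_cast hb
    have hc' : (c : ℤ) = g * m := by exact_mod_cast hc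
    zify at hu' hdeg
    linear_combination hu'.1 - v * hc' - (q - q') * hb' - (a + g * ℓ) * hdeg
  have hqr : q + r = q' + r' := by omega
  rcases Nat.eq_zero_or_pos v with rfl | hv
  · left
    have hr : (r : ℤ) = r' := by
      rcases mul_eq_zero.1 (hvm.symm.trans (by simp)) with h0 | h0
      · omega
      · linarith
    have hr : r = r' := by exact_mod_cast hr
    subst hr
    obtain rfl : q = q' := by omega
    rfl
  right
  have hrr : r' < r := by
    by_contra! hle'
    have e1 : (0 : ℤ) < m * v := by
      have : 0 < m * v := Nat.mul_pos (by omega) hv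
      exact_mod_cast this
    have e2 : (ℓ : ℤ) * (r - r') ≤ 0 := by
      have : (r : ℤ) ≤ r' := by exact_mod_cast hle'
      exact mul_nonpos_of_nonneg_of_nonpos (by positivity) (by linarith)
    linarith
  obtain ⟨w, rfl⟩ := Nat.exists_eq_add_of_le hrr.le
  have hvw : m * v = ℓ * w := by
    push_cast at hvm
    zify
    linear_combination hvm
  obtain ⟨t, rfl⟩ : ℓ ∣ v := hco.dvd_of_dvd_mul_left ⟨w, hvw⟩
  obtain rfl : w = m * t := by
    apply Nat.eq_of_mul_eq_mul_left hℓ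
    rw [← hvw]; ring
  obtain rfl : p' = 0 := by
    by_contra hp'
    exact hα0 (ex p' q' r' (s + ℓ * t)) (by
        simp only [ex_apply_zero, ex_apply_one, ex_apply_two, ex_apply_three]
        omega) hu.symm
      ⟨Nat.pos_of_ne_zero hp', by rw [ex_apply_three]; omega⟩
  obtain rfl : s = 0 := by
    by_contra hs
    exact hα0 _ rfl rfl ⟨by simpa using hv, by simpa using Nat.pos_of_ne_zero hs⟩
  have ht : t = 1 := by
    by_contra ht
    have ht0 : t ≠ 0 := by rintro rfl; simp at hv
    obtain ⟨t, rfl⟩ : ∃ n, t = n + 2 := ⟨t - 2, by omega⟩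
    refine hα0 (ex (ℓ * (t + 1)) (q + m) (r' + m * (t + 1)) ℓ) ?_ ?_ ⟨by simpa using hℓ, by simpa⟩
    · simp only [ex_apply_zero, ex_apply_one, ex_apply_two, ex_apply_three]
      ring
    · rw [uExp_eq_iff]
      simp only [ex_apply_zero, ex_apply_one, ex_apply_two, ex_apply_three]
      rw [hb, hc]
      constructor <;> ring
  subst ht
  refine ⟨q, r', ?_, ?_⟩
  · apply ex_ext <;> simp; ring
  · apply ex_ext <;> simp; omega

end

section

/-! ### Irredundant sets of monomials -/

section Irredundant

variable {σ K : Type*} [Field K]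

/-- If no monomial of a member of `H` divides the monomial with exponent `γ`, that monomial does
not occur in any member of the ideal generated by `H`. -/
lemma coeff_eq_zero_of_mem_span {H : Set (MvPolynomial σ K)} {γ : σ →₀ ℕ}
    (hH : ∀ h ∈ H, ∀ β, coeff β h ≠ 0 → ¬ β ≤ γ) {f : MvPolynomial σ K} (hf : f ∈ Ideal.span H) :
    coeff γ f = 0 := by
  classical
  have hle : Ideal.span H ≤ Ideal.span ((fun s => monomial s (1 : K)) '' {β | ¬ β ≤ γ}) := by
    rw [Ideal.span_le]
    intro h hh
    exact mem_ideal_span_monomial_image.2 fun β hβ => ⟨β, hH h hh β (mem_support_iff.1 hβ), le_rfl⟩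
  by_contra hne
  obtain ⟨β, h1, h2⟩ := mem_ideal_span_monomial_image.1 (hle hf) γ (mem_support_iff.2 hne)
  exact h1 h2

lemma isMinimalGeneratingSet_monomial {Γ : Set (σ →₀ ℕ)} (hΓ : IsAntichain (· ≤ ·) Γ) :
    IsMinimalGeneratingSet (Ideal.span ((fun s => monomial s (1 : K)) '' Γ))
      ((fun s => monomial s (1 : K)) '' Γ) := by
  classical
  refine ⟨rfl, ?_⟩
  rintro _ ⟨γ, hγ, rfl⟩ hmem
  have := coeff_eq_zero_of_mem_span (γ := γ) ?_ hmem
  · simp at this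
  · rintro _ ⟨⟨β, hβ, rfl⟩, hne⟩ β' hβ' hle
    simp only [coeff_monomial, ne_eq, ite_eq_right_iff, one_ne_zero, imp_false, not_not] at hβ'
    subst hβ'
    exact hne (by rw [hΓ.eq hβ hγ hle]; rfl)

lemma isMinimalGeneratingSet_monomial_union_sub {Γ : Set (σ →₀ ℕ)} (hΓ : IsAntichain (· ≤ ·) Γ)
    {μ ν : σ →₀ ℕ} (hμν : μ ≠ ν) (hμ : ∀ γ ∈ Γ, ¬ γ ≤ μ ∧ ¬ μ ≤ γ ∧ ¬ ν ≤ γ) :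
    IsMinimalGeneratingSet
      (Ideal.span ((fun s => monomial s (1 : K)) '' Γ ∪ {monomial μ (1 : K) - monomial ν 1}))
      ((fun s => monomial s (1 : K)) '' Γ ∪ {monomial μ (1 : K) - monomial ν 1}) := by
  classical
  refine ⟨rfl, ?_⟩
  rintro _ (⟨γ, hγ, rfl⟩ | rfl) hmem
  · have := coeff_eq_zero_of_mem_span (γ := γ) ?_ hmem
    · simp at this
    · rintro _ ⟨⟨β, hβ, rfl⟩ | rfl, hne⟩ β' hβ' hle
      · simp only [coeff_monomial, ne_eq, ite_eq_right_iff, one_ne_zero, imp_false, not_not] at hβ'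
        subst hβ'
        exact hne (by rw [hΓ.eq hβ hγ hle]; rfl)
      · rw [coeff_sub, coeff_monomial, coeff_monomial] at hβ'
        by_cases h1 : μ = β'
        · exact (hμ γ hγ).2.1 (h1 ▸ hle)
        · by_cases h2 : ν = β'
          · exact (hμ γ hγ).2.2 (h2 ▸ hle)
          · simp [h1, h2] at hβ'
  · have := coeff_eq_zero_of_mem_span (γ := μ) ?_ hmem
    · simp [coeff_sub, coeff_monomial, hμν.symm] at this
    · rintro _ ⟨⟨β, hβ, rfl⟩ | rfl, hne⟩ β' hβ' hle
      · simp only [coeff_monomial, ne_eq, ite_eq_right_iff, one_ne_zero, imp_false, not_not] at hβ'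
        subst hβ'
        exact (hμ β hβ).1 hle
      · exact hne rfl

end Irredundant

/-! ### Generators of the defining ideal -/

variable (K : Type*) [Field K] {a b c : ℕ}

lemma binom_eq : binom K a b c = monomial (ex (ell a b c) 0 (emm a b c) 0) 1 -
    monomial (ex 0 (emm a b c) 0 (ell a b c)) 1 := by
  rw [monomial_ex, monomial_ex, binom, ell, emm]
  simp

variable {K} in
lemma binom_mem_definingIdeal (h : Admissible a b c) :
    binom K a b c ∈ definingIdeal K a b c := by
  rw [binom_eq]
  apply sub_mem_definingIdeal
  · simp only [degree_fin_four, ex_apply_zero, ex_apply_one, ex_apply_two, ex_apply_three]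
    omega
  · obtain ⟨g, ℓ, m, k, hg, hℓ, hk, hm, hco, hd, hc, hk', h1, h2⟩ := h.exists_ell
    rw [ell, emm, h1, h2, uExp_eq_iff]
    have hb : b = a + g * ℓ := by have := h.2.1; omega
    simp only [ex_apply_zero, ex_apply_one, ex_apply_two, ex_apply_three]
    rw [hb, hc]
    constructor <;> ring

variable (a b c) in
/-- The ideal generated by the dead monomials. -/
noncomputable def deadIdeal : Ideal (MvPolynomial (Fin 4) K) :=
  Ideal.span ((fun s => monomial s (1 : K)) '' {α | Dead a b c α})

lemma monomial_sub_mem (h : Admissible a b c) {α β : Fin 4 →₀ ℕ} (hdeg : α.degree = β.degree)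
    (hu : uExp a b c α = uExp a b c β) (hα : ¬ Dead a b c α) :
    monomial α (1 : K) - monomial β 1 ∈ Ideal.span {binom K a b c} := by
  wlog hle : β 0 ≤ α 0 generalizing α β
  · rw [← neg_mem_iff, neg_sub]
    exact this hdeg.symm hu.symm (by rwa [← dead_congr hdeg hu]) (le_of_not_ge hle)
  rcases eq_of_uExp_eq h hdeg hu hα (lt_or_eq_of_le hle) with rfl | ⟨q, r, rfl, rfl⟩
  · simp
  · have : monomial (ex (ell a b c) q (emm a b c + r) 0) (1 : K) -
        monomial (ex 0 (emm a b c + q) r (ell a b c)) 1 =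
        monomial (ex 0 q r 0) 1 * binom K a b c := by
      rw [binom_eq, mul_sub, monomial_mul, monomial_mul, ex_add, ex_add]
      simp [add_comm]
    rw [this]
    exact Ideal.mul_mem_left _ _ (Ideal.mem_span_singleton_self _)

/-- The defining ideal is generated by the dead monomials and the binomial. -/
lemma definingIdeal_eq (h : Admissible a b c) :
    definingIdeal K a b c = deadIdeal K a b c ⊔ Ideal.span {binom K a b c} := by
  classical
  apply le_antisymm
  · intro f hf
    rw [f.as_sum, ← Finset.sum_fiberwise_of_maps_to
      (t := f.support.image fun α => (α.degree, uExp a b c α))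
      (g := fun α => (α.degree, uExp a b c α)) (fun α hα => Finset.mem_image_of_mem _ hα)]
    refine sum_mem fun y hy => ?_
    obtain ⟨α, -, rfl⟩ := Finset.mem_image.1 hy
    simp only [Prod.mk.injEq]
    have hC : ∀ (β : Fin 4 →₀ ℕ) (r : K), monomial β r = C r * monomial β 1 := fun β r => by
      rw [C_mul_monomial, mul_one]
    by_cases hα : Dead a b c α
    · refine sum_mem fun β hβ => Ideal.mem_sup_left ?_
      obtain ⟨h1, h2⟩ := (Finset.mem_filter.1 hβ).2
      rw [hC]
      exact Ideal.mul_mem_left _ _ (Ideal.subset_span ⟨β, (dead_congr h1 h2).2 hα, rfl⟩)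
    · have h0 := sum_coeff_eq_zero_of_mem K a b c hf hα
      have h1 : ∑ β ∈ f.support with β.degree = α.degree ∧ uExp a b c β = uExp a b c α,
          C (coeff β f) * monomial α 1 = 0 := by
        rw [← Finset.sum_mul, ← map_sum, h0, map_zero, zero_mul]
      rw [← sub_zero (Finset.sum _ _), ← h1, ← Finset.sum_sub_distrib]
      refine sum_mem fun β hβ => Ideal.mem_sup_right ?_
      obtain ⟨h1, h2⟩ := (Finset.mem_filter.1 hβ).2
      rw [hC, ← mul_sub]
      exact Ideal.mul_mem_left _ _
        (monomial_sub_mem K h h1 h2 (by rwa [dead_congr h1 h2]))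
  · refine sup_le ?_ ?_
    · rw [deadIdeal, Ideal.span_le]
      rintro _ ⟨α, hα, rfl⟩
      exact monomial_mem_definingIdeal hα
    · rw [Ideal.span_singleton_le_iff_mem]
      exact binom_mem_definingIdeal h

/-- The exponents of `z₁ z₄` and of `z₁ ^ p * z₃ ^ r`, `z₂ ^ r * z₄ ^ p` for `(p, r) ∈ M`. -/
def genExps (M : Set (ℕ × ℕ)) : Set (Fin 4 →₀ ℕ) :=
  {α | α = ex 1 0 0 1 ∨ ∃ p ∈ M, α = ex p.1 0 p.2 0 ∨ α = ex 0 p.2 0 p.1}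

lemma baseGens_union_extraGens (i j : ℕ) (E : Finset (ℕ × ℕ)) :
    baseGens K i j ∪ extraGens K E =
      (fun s => monomial s (1 : K)) '' genExps (insert (i, j) (E : Set (ℕ × ℕ))) := by
  ext f
  simp only [baseGens, extraGens, genExps, Set.mem_union, Set.mem_insert_iff, Set.mem_singleton_iff,
    Set.mem_ofPred_eq, Set.mem_image, Finset.mem_coe]
  constructor
  · rintro ((rfl | rfl | rfl) | ⟨p, hp, rfl | rfl⟩)
    · exact ⟨_, Or.inl rfl, by rw [monomial_ex]; simp⟩
    · exact ⟨_, Or.inr ⟨_, Or.inl rfl, Or.inl rfl⟩, by rw [monomial_ex]; simp⟩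
    · exact ⟨_, Or.inr ⟨_, Or.inl rfl, Or.inr rfl⟩, by rw [monomial_ex]; simp⟩
    · exact ⟨_, Or.inr ⟨_, Or.inr hp, Or.inl rfl⟩, by rw [monomial_ex]; simp⟩
    · exact ⟨_, Or.inr ⟨_, Or.inr hp, Or.inr rfl⟩, by rw [monomial_ex]; simp⟩
  · rintro ⟨α, rfl | ⟨p, rfl | hp, rfl | rfl⟩, rfl⟩ <;> rw [monomial_ex]
    · left; left; simp
    · left; right; left; simp
    · left; right; right; simp
    · right; exact ⟨p, hp, Or.inl (by simp)⟩
    · right; exact ⟨p, hp, Or.inr (by simp)⟩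

lemma isAntichain_genExps {M : Set (ℕ × ℕ)} (hM : IsAntichain (· ≤ ·) M)
    (hpos : ∀ p ∈ M, 0 < p.1 ∧ 0 < p.2) : IsAntichain (· ≤ ·) (genExps M) := by
  intro α hα β hβ hne hle
  rw [le_iff_fin_four] at hle
  rcases hα with rfl | ⟨p, hp, rfl | rfl⟩ <;> rcases hβ with rfl | ⟨q, hq, rfl | rfl⟩ <;>
    simp only [ex_apply_zero, ex_apply_one, ex_apply_two, ex_apply_three] at hle
  · exact hne rfl
  · omega
  · omega
  · have := hpos p hp; omega
  · exact hne (by rw [hM.eq hp hq ⟨hle.1, hle.2.2.1⟩])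
  · have := hpos p hp; omega
  · have := hpos p hp; omega
  · have := hpos p hp; omega
  · exact hne (by rw [hM.eq hp hq ⟨hle.2.2.2, hle.2.1⟩])

variable (a b c) in
/-- The exponents `(p, r)` of the monomials `z₁ ^ p * z₃ ^ r` in the minimal generating set: the
minimal dead ones, except that, when the binomial is needed, the multiples of its leading monomial
are left out. -/
def minPairs : Set (ℕ × ℕ) :=
  {p | Minimal (fun p : ℕ × ℕ => DeadPair a b c p.1 p.2) p ∧
    (DeadPair a b c (ell a b c) (emm a b c) ∨ ¬ (ell a b c, emm a b c) ≤ p)}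

lemma isAntichain_minPairs : IsAntichain (· ≤ ·) (minPairs a b c) :=
  (setOfPred_minimal_antichain _).subset fun _ hp => hp.1

lemma finite_minPairs : (minPairs a b c).Finite :=
  WellQuasiOrderedLE.finite_of_isAntichain isAntichain_minPairs

lemma pos_of_mem_minPairs (h : Admissible a b c) : ∀ p ∈ minPairs a b c, 0 < p.1 ∧ 0 < p.2 := by
  obtain ⟨i, j, hl⟩ := exists_isLeast_posetS h
  intro p hp
  have h1 := (DeadPair.le_of_isLeast h hl hp.1.1)
  have h2 := ((mem_posetS_iff h).1 hl.1).2.1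
  omega

lemma mem_minPairs_of_isLeast (h : Admissible a b c) {i j : ℕ}
    (hl : IsLeast (posetS a b c) (i, j)) : (i, j) ∈ minPairs a b c := by
  refine ⟨⟨deadPair_of_mem_posetS h hl.1, ?_⟩, Or.inr fun hle => ?_⟩
  · rintro ⟨p, r⟩ hd hle
    have h1 := DeadPair.le_of_isLeast h hl hd
    have h2 : p ≤ i := hle.1
    have h3 : r ≤ j := hle.2
    have h4 : r = j := by omega
    exact ⟨h1.2.2 h4, h4.ge⟩
  · have h1 := lt_emm_of_isLeast h hl
    have h2 : emm a b c ≤ j := hle.2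
    omega

lemma genExps_minPairs_dead (h : Admissible a b c) {α : Fin 4 →₀ ℕ}
    (hα : α ∈ genExps (minPairs a b c)) : Dead a b c α := by
  rcases hα with rfl | ⟨p, hp, rfl | rfl⟩
  · exact dead_of_pos h (by simp) (by simp)
  · exact hp.1.1
  · exact dead_ex_reverse hp.1.1

lemma definingIdeal_eq_of_dead (h : Admissible a b c)
    (hA : DeadPair a b c (ell a b c) (emm a b c)) :
    definingIdeal K a b c =
      Ideal.span ((fun s => monomial s (1 : K)) '' genExps (minPairs a b c)) := by
  have hmin : ∀ {p r}, DeadPair a b c p r → ∃ q ∈ minPairs a b c, q.1 ≤ p ∧ q.2 ≤ r := by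
    intro p r hd
    obtain ⟨q, hq, hmin⟩ := exists_minimal_le_of_wellFoundedLT
      (fun p : ℕ × ℕ => DeadPair a b c p.1 p.2) (p, r) hd
    exact ⟨q, ⟨hmin, Or.inl hA⟩, hq.1, hq.2⟩
  rw [definingIdeal_eq K h]
  have hdead : ∀ α, Dead a b c α → monomial α (1 : K) ∈
      Ideal.span ((fun s => monomial s (1 : K)) '' genExps (minPairs a b c)) := by
    intro α hα
    rw [mem_ideal_span_monomial_image]
    intro ξ hξ
    obtain rfl : ξ = α := by
      have := support_monomial_subset hξ
      simpa using this
    rcases (dead_iff h).1 hα with h1 | h1 | h1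
    · exact ⟨_, Or.inl rfl, le_iff_fin_four.2 ⟨h1.1, by simp, by simp, h1.2⟩⟩
    · obtain ⟨q, hq, h2, h3⟩ := hmin h1
      exact ⟨_, Or.inr ⟨q, hq, Or.inl rfl⟩, le_iff_fin_four.2 ⟨h2, by simp, h3, by simp⟩⟩
    · obtain ⟨q, hq, h2, h3⟩ := hmin h1
      exact ⟨_, Or.inr ⟨q, hq, Or.inr rfl⟩, le_iff_fin_four.2 ⟨by simp, h3, by simp, h2⟩⟩
  apply le_antisymm
  · refine sup_le ?_ ?_
    · rw [deadIdeal, Ideal.span_le]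
      rintro _ ⟨α, hα, rfl⟩
      exact hdead α hα
    · rw [Ideal.span_singleton_le_iff_mem, binom_eq]
      exact sub_mem (hdead _ hA) (hdead _ (dead_ex_reverse hA))
  · refine le_sup_of_le_left (Ideal.span_mono (Set.image_mono fun α hα => ?_))
    exact genExps_minPairs_dead h hα

lemma definingIdeal_eq_of_not_dead (h : Admissible a b c)
    (hA : ¬ DeadPair a b c (ell a b c) (emm a b c)) :
    definingIdeal K a b c =
      Ideal.span ((fun s => monomial s (1 : K)) '' genExps (minPairs a b c) ∪ {binom K a b c}) := by
  set L := Ideal.span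
    ((fun s => monomial s (1 : K)) '' genExps (minPairs a b c) ∪ {binom K a b c}) with hL
  have hB : binom K a b c ∈ L := Ideal.subset_span (Or.inr rfl)
  have hG : ∀ {α γ : Fin 4 →₀ ℕ}, γ ∈ genExps (minPairs a b c) → γ ≤ α →
      monomial α (1 : K) ∈ L := by
    intro α γ hγ hle
    refine Ideal.mem_of_dvd _ ?_ (Ideal.subset_span (Or.inl ⟨γ, hγ, rfl⟩))
    exact monomial_dvd_monomial.2 ⟨Or.inr hle, one_dvd _⟩
  have h14 : ∀ {α : Fin 4 →₀ ℕ}, 0 < α 0 → 0 < α 3 → monomial α (1 : K) ∈ L := fun h0 h3 =>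
    hG (Or.inl rfl) (le_iff_fin_four.2 ⟨h0, by simp, by simp, h3⟩)
  -- a multiple of the leading monomial that is dead involves one more factor `z₁`
  have hmin : ∀ {p r}, DeadPair a b c p r → (∃ q ∈ minPairs a b c, q.1 ≤ p ∧ q.2 ≤ r) ∨
      (ell a b c < p ∧ emm a b c ≤ r) := by
    intro p r hd
    obtain ⟨q, hq, hmin⟩ := exists_minimal_le_of_wellFoundedLT
      (fun p : ℕ × ℕ => DeadPair a b c p.1 p.2) (p, r) hd
    by_cases hle : (ell a b c, emm a b c) ≤ q
    · right
      have h1 : ell a b c ≤ q.1 := hle.1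
      have h2 : emm a b c ≤ q.2 := hle.2
      have h3 : q.1 ≤ p := hq.1
      have h4 : q.2 ≤ r := hq.2
      refine ⟨lt_of_le_of_ne (h1.trans h3) fun heq => hA ?_, h2.trans h4⟩
      subst heq
      exact deadPair_ell_emm_of_add h hd
    · exact Or.inl ⟨q, ⟨hmin, Or.inr hle⟩, hq.1, hq.2⟩
  rw [definingIdeal_eq K h]
  apply le_antisymm
  · refine sup_le ?_ (by rwa [Ideal.span_singleton_le_iff_mem])
    rw [deadIdeal, Ideal.span_le]
    rintro _ ⟨α, hα, rfl⟩
    obtain ⟨p, q, r, s, rfl⟩ := exists_ex α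
    simp only [SetLike.mem_coe]
    rcases (dead_iff h).1 hα with h1 | h1 | h1
    · exact h14 h1.1 h1.2
    · rcases hmin h1 with ⟨u, hu, h2, h3⟩ | ⟨h2, h3⟩
      · exact hG (Or.inr ⟨u, hu, Or.inl rfl⟩) (le_iff_fin_four.2 ⟨h2, by simp, h3, by simp⟩)
      · simp only [ex_apply_zero, ex_apply_two] at h2 h3
        have : monomial (ex p q r s) (1 : K) =
            monomial (ex (p - ell a b c) q (r - emm a b c) s) 1 * binom K a b c +
            monomial (ex (p - ell a b c) (q + emm a b c) (r - emm a b c) (s + ell a b c)) 1 := by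
          rw [binom_eq, mul_sub, monomial_mul, monomial_mul, ex_add, ex_add, mul_one,
            Nat.sub_add_cancel h2.le, Nat.sub_add_cancel h3]
          simp
        rw [this]
        exact add_mem (Ideal.mul_mem_left _ _ hB)
          (h14 (by simpa using h2) (by have := ell_pos h; simp; omega))
    · rcases hmin h1 with ⟨u, hu, h2, h3⟩ | ⟨h2, h3⟩
      · exact hG (Or.inr ⟨u, hu, Or.inr rfl⟩) (le_iff_fin_four.2 ⟨by simp, h3, by simp, h2⟩)
      · simp only [ex_apply_one, ex_apply_three] at h2 h3
        have : monomial (ex p q r s) (1 : K) =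
            monomial (ex (p + ell a b c) (q - emm a b c) (r + emm a b c) (s - ell a b c)) 1 -
            monomial (ex p (q - emm a b c) r (s - ell a b c)) 1 * binom K a b c := by
          rw [binom_eq, mul_sub, monomial_mul, monomial_mul, ex_add, ex_add, mul_one,
            Nat.sub_add_cancel h2.le, Nat.sub_add_cancel h3]
          simp
        rw [this]
        exact sub_mem (h14 (by have := ell_pos h; simp; omega) (by simpa using h2))
          (Ideal.mul_mem_left _ _ hB)
  · rw [hL, Ideal.span_union]
    exact sup_le_sup_right (Ideal.span_mono (Set.image_mono fun α hα =>
      genExps_minPairs_dead h hα)) _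

lemma isMinimalGeneratingSet_of_dead (h : Admissible a b c)
    (hA : DeadPair a b c (ell a b c) (emm a b c)) :
    IsMinimalGeneratingSet (definingIdeal K a b c)
      ((fun s => monomial s (1 : K)) '' genExps (minPairs a b c)) := by
  rw [definingIdeal_eq_of_dead K h hA]
  exact isMinimalGeneratingSet_monomial
    (isAntichain_genExps isAntichain_minPairs (pos_of_mem_minPairs h))

lemma isMinimalGeneratingSet_of_not_dead (h : Admissible a b c)
    (hA : ¬ DeadPair a b c (ell a b c) (emm a b c)) :
    IsMinimalGeneratingSet (definingIdeal K a b c)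
      ((fun s => monomial s (1 : K)) '' genExps (minPairs a b c) ∪ {binom K a b c}) := by
  rw [definingIdeal_eq_of_not_dead K h hA, binom_eq]
  have hℓ := ell_pos h
  have hpos := pos_of_mem_minPairs h
  refine isMinimalGeneratingSet_monomial_union_sub
    (isAntichain_genExps isAntichain_minPairs hpos) (fun heq => ?_) fun γ hγ => ⟨?_, ?_, ?_⟩
  · have := congrArg (fun α => α 0) heq
    simp only [ex_apply_zero] at this
    omega
  · exact fun hle => hA ((genExps_minPairs_dead h hγ).mono hle)
  all_goals
    intro hle
    rw [le_iff_fin_four] at hle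
    rcases hγ with rfl | ⟨p, hp, rfl | rfl⟩ <;>
      simp only [ex_apply_zero, ex_apply_one, ex_apply_two, ex_apply_three] at hle
  · have : emm a b c = 0 := by omega
    exact absurd (lt_emm_of_isLeast h (exists_isLeast_posetS h).choose_spec.choose_spec) (by omega)
  · exact (hp.2.resolve_left hA) ⟨hle.1, hle.2.2.1⟩
  · omega
  · have : emm a b c = 0 := by omega
    exact absurd (lt_emm_of_isLeast h (exists_isLeast_posetS h).choose_spec.choose_spec) (by omega)
  · omega
  · exact (hp.2.resolve_left hA) ⟨hle.2.2.2, hle.2.1⟩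

/-! ### The four cases -/

variable {i j : ℕ}

/-- Some minimal generator `z₁ ^ p * z₃ ^ r` besides `z₁ ^ i * z₃ ^ j` exists. -/
lemma exists_isExtra (h : Admissible a b c) (hl : IsLeast (posetS a b c) (i, j))
    (hM : minPairs a b c ≠ {(i, j)}) : ∃ E, IsExtra i j E ∧
      insert (i, j) (E : Set (ℕ × ℕ)) = minPairs a b c := by
  classical
  have hmem := mem_minPairs_of_isLeast h hl
  set E : Finset (ℕ × ℕ) := (finite_minPairs (a := a) (b := b) (c := c)).toFinset.erase (i, j)
    with hEdef
  have hE : insert (i, j) (E : Set (ℕ × ℕ)) = minPairs a b c := by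
    rw [hEdef, Finset.coe_erase, Set.Finite.coe_toFinset, Set.insert_sdiff_singleton,
      Set.insert_eq_of_mem hmem]
  refine ⟨E, ⟨?_, by simp [hEdef], fun p hp => ?_⟩, hE⟩
  · rw [Finset.nonempty_iff_ne_empty]
    intro h0
    rw [h0] at hE
    exact hM (by simpa using hE.symm)
  · exact pos_of_mem_minPairs h p (by simpa using (Finset.mem_erase.1 hp).2)

lemma baseGens_eq : baseGens K i j = (fun s => monomial s (1 : K)) '' genExps {(i, j)} := by
  have := baseGens_union_extraGens K i j ∅
  simpa [extraGens] using this

lemma caseI_of (h : Admissible a b c)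
    (hA : DeadPair a b c (ell a b c) (emm a b c)) (hM : minPairs a b c = {(i, j)}) :
    CaseI K a b c i j := by
  rw [CaseI, baseGens_eq, ← hM]
  exact isMinimalGeneratingSet_of_dead K h hA

lemma caseII_of (h : Admissible a b c) (hl : IsLeast (posetS a b c) (i, j))
    (hA : DeadPair a b c (ell a b c) (emm a b c)) (hM : minPairs a b c ≠ {(i, j)}) :
    CaseII K a b c i j := by
  obtain ⟨E, hE, hEM⟩ := exists_isExtra h hl hM
  refine ⟨E, hE, ?_⟩
  rw [baseGens_union_extraGens, hEM]
  exact isMinimalGeneratingSet_of_dead K h hA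

lemma caseIII_of (h : Admissible a b c)
    (hA : ¬ DeadPair a b c (ell a b c) (emm a b c)) (hM : minPairs a b c = {(i, j)}) :
    CaseIII K a b c i j := by
  rw [CaseIII, baseGens_eq, ← hM]
  exact isMinimalGeneratingSet_of_not_dead K h hA

lemma caseIV_of (h : Admissible a b c) (hl : IsLeast (posetS a b c) (i, j))
    (hA : ¬ DeadPair a b c (ell a b c) (emm a b c)) (hM : minPairs a b c ≠ {(i, j)}) :
    CaseIV K a b c i j := by
  obtain ⟨E, hE, hEM⟩ := exists_isExtra h hl hM
  refine ⟨E, hE, ?_⟩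
  rw [Set.union_right_comm, baseGens_union_extraGens, hEM]
  exact isMinimalGeneratingSet_of_not_dead K h hA

end

section

/-! ### A regular element -/

section Coefficients

variable {K : Type*} [Field K] (f : MvPolynomial (Fin 4) K) (p q r s : ℕ)

lemma coeff_ex_X_zero_mul_succ :
    coeff (ex (p + 1) q r s) (X 0 * f) = coeff (ex p q r s) f := by
  rw [← coeff_X_mul (ex p q r s) 0 f]
  congr 1
  apply ex_ext <;> simp [add_comm]

lemma coeff_ex_X_one_mul_succ :
    coeff (ex p (q + 1) r s) (X 1 * f) = coeff (ex p q r s) f := by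
  rw [← coeff_X_mul (ex p q r s) 1 f]
  congr 1
  apply ex_ext <;> simp [add_comm]

lemma coeff_ex_X_two_mul_succ :
    coeff (ex p q (r + 1) s) (X 2 * f) = coeff (ex p q r s) f := by
  rw [← coeff_X_mul (ex p q r s) 2 f]
  congr 1
  apply ex_ext <;> simp [add_comm]

lemma coeff_ex_X_three_mul_succ :
    coeff (ex p q r (s + 1)) (X 3 * f) = coeff (ex p q r s) f := by
  rw [← coeff_X_mul (ex p q r s) 3 f]
  congr 1
  apply ex_ext <;> simp [add_comm]

lemma coeff_X_mul_of_eq_zero {α : Fin 4 →₀ ℕ} {k : Fin 4} (h : α k = 0) :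
    coeff α (X k * f) = 0 := by
  classical
  rw [coeff_X_mul', if_neg (by simpa using h)]

end Coefficients

variable (K : Type*) [Field K] {a b c : ℕ}

variable (a b c) in
/-- The monomial `z₁ ^ p * z₃ ^ r` is dead or a multiple of the leading monomial of the binomial. -/
def MarkedPair (p r : ℕ) : Prop := DeadPair a b c p r ∨ ell a b c ≤ p ∧ emm a b c ≤ r

variable (a b c) in
/-- The exponents of the monomials in the ideal `J + (z₁ ^ ℓ * z₃ ^ m)`. -/
def Marked (α : Fin 4 →₀ ℕ) : Prop :=
  (0 < α 0 ∧ 0 < α 3) ∨ MarkedPair a b c (α 0) (α 2) ∨ MarkedPair a b c (α 3) (α 1)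

lemma MarkedPair.mono {p r p' r' : ℕ} (h : MarkedPair a b c p r) (hp : p ≤ p') (hr : r ≤ r') :
    MarkedPair a b c p' r' :=
  h.imp (fun h => h.mono hp hr) fun h => ⟨h.1.trans hp, h.2.trans hr⟩

lemma MarkedPair.pos (h : Admissible a b c) {p r : ℕ} (hm : MarkedPair a b c p r) : 0 < p := by
  rcases hm with hm | hm
  · obtain ⟨i, j, hl⟩ := exists_isLeast_posetS h
    exact (hm.le_of_isLeast h hl).1
  · exact (ell_pos h).trans_le hm.1

lemma Marked.mono {α β : Fin 4 →₀ ℕ} (h : Marked a b c α) (hle : α ≤ β) : Marked a b c β := by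
  rw [le_iff_fin_four] at hle
  rcases h with h | h | h
  · exact Or.inl ⟨by omega, by omega⟩
  · exact Or.inr (Or.inl (h.mono hle.1 hle.2.2.1))
  · exact Or.inr (Or.inr (h.mono hle.2.2.2 hle.2.1))

variable (a b c) in
/-- The monomial ideal `J + (z₁ ^ ℓ * z₃ ^ m)`. -/
noncomputable def markedIdeal : Ideal (MvPolynomial (Fin 4) K) :=
  Ideal.span ((fun s => monomial s (1 : K)) '' {α | Marked a b c α})

variable {K}

lemma mem_span_monomial_iff {σ : Type*} {P : (σ →₀ ℕ) → Prop}
    (hP : ∀ α β, α ≤ β → P α → P β) {f : MvPolynomial σ K} :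
    f ∈ Ideal.span ((fun s => monomial s (1 : K)) '' {α | P α}) ↔
      ∀ α, ¬ P α → coeff α f = 0 := by
  rw [mem_ideal_span_monomial_image]
  constructor
  · intro h α hα
    by_contra hne
    obtain ⟨β, h1, h2⟩ := h α (mem_support_iff.2 hne)
    exact hα (hP _ _ h2 h1)
  · intro h α hα
    by_contra! hne
    exact mem_support_iff.1 hα (h α fun h1 => hne α h1 le_rfl)

lemma mem_markedIdeal_iff {f : MvPolynomial (Fin 4) K} :
    f ∈ markedIdeal K a b c ↔ ∀ α, ¬ Marked a b c α → coeff α f = 0 :=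
  mem_span_monomial_iff fun _ _ h1 h2 => h2.mono h1

/-- Induction on the exponent of `z₃` (for monomials without `z₄`) or of `z₂` (for monomials without
`z₁`). -/
lemma mem_markedIdeal_of_mul (h : Admissible a b c) {f : MvPolynomial (Fin 4) K}
    (hf : (X 1 + X 2) * f ∈ markedIdeal K a b c) : f ∈ markedIdeal K a b c := by
  rw [mem_markedIdeal_iff] at hf ⊢
  have hunm : ∀ {p q r s}, ¬ Marked a b c (ex p q r s) ↔
      ((s = 0 ∧ ¬ MarkedPair a b c p r) ∨ (p = 0 ∧ ¬ MarkedPair a b c s q)) := by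
    intro p q r s
    have h0 : ∀ t, ¬ MarkedPair a b c 0 t := fun t ht => (ht.pos h).false
    simp only [Marked, ex_apply_zero, ex_apply_one, ex_apply_two, ex_apply_three, not_or]
    constructor
    · rintro ⟨h1, h2, h3⟩
      obtain rfl | rfl : s = 0 ∨ p = 0 := by omega
      · exact Or.inl ⟨rfl, h2⟩
      · exact Or.inr ⟨rfl, h3⟩
    · rintro (⟨rfl, h1⟩ | ⟨rfl, h1⟩)
      · exact ⟨by simp, h1, h0 _⟩
      · exact ⟨by simp, h0 _, h1⟩
  have h4 : ∀ r p q, ¬ MarkedPair a b c p r → coeff (ex p q r 0) f = 0 := by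
    intro r
    induction r with
    | zero =>
      intro p q hp
      have := hf (ex p (q + 1) 0 0) (hunm.2 (Or.inl ⟨rfl, hp⟩))
      rwa [add_mul, coeff_add, coeff_ex_X_one_mul_succ, coeff_X_mul_of_eq_zero _ (by simp),
        add_zero] at this
    | succ r ih =>
      intro p q hp
      have := hf (ex p (q + 1) (r + 1) 0) (hunm.2 (Or.inl ⟨rfl, hp⟩))
      rwa [add_mul, coeff_add, coeff_ex_X_one_mul_succ, coeff_ex_X_two_mul_succ,
        ih _ _ (fun h' => hp (h'.mono le_rfl (Nat.le_succ r))), add_zero] at this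
  have h1 : ∀ q r s, ¬ MarkedPair a b c s q → coeff (ex 0 q r s) f = 0 := by
    intro q
    induction q with
    | zero =>
      intro r s hp
      have := hf (ex 0 0 (r + 1) s) (hunm.2 (Or.inr ⟨rfl, hp⟩))
      rwa [add_mul, coeff_add, coeff_ex_X_two_mul_succ, coeff_X_mul_of_eq_zero _ (by simp),
        zero_add] at this
    | succ q ih =>
      intro r s hp
      have := hf (ex 0 (q + 1) (r + 1) s) (hunm.2 (Or.inr ⟨rfl, hp⟩))
      rwa [add_mul, coeff_add, coeff_ex_X_one_mul_succ, coeff_ex_X_two_mul_succ,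
        ih _ _ (fun h' => hp (h'.mono le_rfl (Nat.le_succ q))), zero_add] at this
  intro α hα
  obtain ⟨p, q, r, s, rfl⟩ := exists_ex α
  rcases hunm.1 hα with ⟨rfl, hp⟩ | ⟨rfl, hp⟩
  · exact h4 r p q hp
  · exact h1 q r s hp

lemma marked_of_dead (h : Admissible a b c) {α : Fin 4 →₀ ℕ} (hα : Dead a b c α) :
    Marked a b c α := by
  rcases (dead_iff h).1 hα with h1 | h1 | h1
  · exact Or.inl h1
  · exact Or.inr (Or.inl (Or.inl h1))
  · exact Or.inr (Or.inr (Or.inl h1))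

lemma definingIdeal_le_markedIdeal (h : Admissible a b c) :
    definingIdeal K a b c ≤ markedIdeal K a b c := by
  rw [definingIdeal_eq K h]
  refine sup_le (Ideal.span_mono (Set.image_mono fun α hα => marked_of_dead h hα)) ?_
  rw [Ideal.span_singleton_le_iff_mem, binom_eq]
  exact sub_mem
    (Ideal.subset_span ⟨_, Or.inr (Or.inl (Or.inr ⟨le_rfl, le_rfl⟩)), rfl⟩)
    (Ideal.subset_span ⟨_, Or.inr (Or.inr (Or.inr ⟨le_rfl, le_rfl⟩)), rfl⟩)

lemma markedIdeal_le (h : Admissible a b c) : markedIdeal K a b c ≤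
    definingIdeal K a b c ⊔ Ideal.span {monomial (ex (ell a b c) 0 (emm a b c) 0) (1 : K)} := by
  have hA : monomial (ex (ell a b c) 0 (emm a b c) 0) (1 : K) ∈ definingIdeal K a b c ⊔
      Ideal.span {monomial (ex (ell a b c) 0 (emm a b c) 0) (1 : K)} :=
    Ideal.mem_sup_right (Ideal.mem_span_singleton_self _)
  have hC : monomial (ex 0 (emm a b c) 0 (ell a b c)) (1 : K) ∈ definingIdeal K a b c ⊔
      Ideal.span {monomial (ex (ell a b c) 0 (emm a b c) 0) (1 : K)} := by
    have : monomial (ex 0 (emm a b c) 0 (ell a b c)) (1 : K) =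
        monomial (ex (ell a b c) 0 (emm a b c) 0) 1 - binom K a b c := by
      rw [binom_eq]; ring
    rw [this]
    exact sub_mem hA (Ideal.mem_sup_left (binom_mem_definingIdeal h))
  rw [markedIdeal, Ideal.span_le]
  rintro _ ⟨α, hα, rfl⟩
  rcases hα with h1 | (h1 | h1) | (h1 | h1)
  · exact Ideal.mem_sup_left (monomial_mem_definingIdeal ((dead_iff h).2 (Or.inl h1)))
  · exact Ideal.mem_sup_left (monomial_mem_definingIdeal ((dead_iff h).2 (Or.inr (Or.inl h1))))
  · refine Ideal.mem_of_dvd _ (monomial_dvd_monomial.2 ⟨Or.inr ?_, one_dvd _⟩) hA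
    exact le_iff_fin_four.2 ⟨h1.1, by simp, h1.2, by simp⟩
  · exact Ideal.mem_sup_left (monomial_mem_definingIdeal ((dead_iff h).2 (Or.inr (Or.inr h1))))
  · refine Ideal.mem_of_dvd _ (monomial_dvd_monomial.2 ⟨Or.inr ?_, one_dvd _⟩) hC
    exact le_iff_fin_four.2 ⟨by simp, h1.2, by simp, h1.1⟩

lemma monomial_ell_succ_mem (h : Admissible a b c) :
    X 0 * monomial (ex (ell a b c) 0 (emm a b c) 0) (1 : K) ∈ definingIdeal K a b c := by
  have : X 0 * monomial (ex (ell a b c) 0 (emm a b c) 0) (1 : K) =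
      X 0 * binom K a b c + X 0 * monomial (ex 0 (emm a b c) 0 (ell a b c)) 1 := by
    rw [binom_eq]; ring
  rw [this]
  refine add_mem (Ideal.mul_mem_left _ _ (binom_mem_definingIdeal h)) ?_
  rw [X, monomial_mul, mul_one]
  exact monomial_mem_definingIdeal (dead_of_pos h (by simp) (by simpa using ell_pos h))

lemma X_three_mul_monomial_mem (h : Admissible a b c) {p q r s : ℕ} (hp : 0 < p) :
    X 3 * monomial (ex p q r s) (1 : K) ∈ definingIdeal K a b c := by
  rw [X, monomial_mul, mul_one]
  exact monomial_mem_definingIdeal (dead_of_pos h (by simpa) (by simp))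

lemma X_zero_mul_monomial_mem (h : Admissible a b c) {p q r s : ℕ} (hs : 0 < s) :
    X 0 * monomial (ex p q r s) (1 : K) ∈ definingIdeal K a b c := by
  rw [X, monomial_mul, mul_one]
  exact monomial_mem_definingIdeal (dead_of_pos h (by simp) (by simpa))

lemma mem_span_X_zero_three_iff {g : MvPolynomial (Fin 4) K} :
    g ∈ Ideal.span (X '' ({0, 3} : Set (Fin 4))) ↔ ∀ q r, coeff (ex 0 q r 0) g = 0 := by
  rw [mem_ideal_span_X_image]
  constructor
  · intro hg q r
    by_contra hne
    obtain ⟨k, rfl | rfl, hk⟩ := hg _ (mem_support_iff.2 hne) <;> simp at hk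
  · intro hg α hα
    by_contra! hne
    obtain ⟨p, q, r, s, rfl⟩ := exists_ex α
    obtain rfl : p = 0 := hne 0 (by simp)
    obtain rfl : s = 0 := hne 3 (by simp)
    exact mem_support_iff.1 hα (hg q r)

/-- If the leading monomial of the binomial is alive, its annihilator in the fiber cone is contained
in `(z₁, z₄)`. -/
lemma mem_span_of_monomial_mul_mem (h : Admissible a b c)
    (hA : ¬ DeadPair a b c (ell a b c) (emm a b c)) {g : MvPolynomial (Fin 4) K}
    (hg : monomial (ex (ell a b c) 0 (emm a b c) 0) 1 * g ∈ definingIdeal K a b c) :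
    g ∈ Ideal.span (X '' ({0, 3} : Set (Fin 4))) := by
  classical
  have h0 : ∀ t, ¬ DeadPair a b c 0 t := fun t ht =>
    (MarkedPair.pos h (Or.inl ht : MarkedPair a b c 0 t)).false
  have hℓ := ell_pos h
  -- the sum of the coefficients of two monomials with the same product vanishes on `J`
  have hsum : ∀ f ∈ definingIdeal K a b c, ∀ q r,
      coeff (ex (ell a b c) q (emm a b c + r) 0) f +
        coeff (ex 0 (emm a b c + q) r (ell a b c)) f = 0 := by
    intro f hf q r
    rw [definingIdeal_eq K h] at hf
    obtain ⟨d, hd, f', hf', rfl⟩ := Submodule.mem_sup.1 hf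
    obtain ⟨t, rfl⟩ := Ideal.mem_span_singleton'.1 hf'
    have hd0 : ∀ α, ¬ Dead a b c α → coeff α d = 0 :=
      (mem_span_monomial_iff fun _ _ h1 h2 => Dead.mono h2 h1).1 hd
    rw [coeff_add, coeff_add, hd0, hd0, zero_add, zero_add, binom_eq, mul_sub, coeff_sub, coeff_sub,
      coeff_mul_monomial', coeff_mul_monomial', coeff_mul_monomial', coeff_mul_monomial',
      if_pos (le_iff_fin_four.2 (by simp)), if_neg (fun h' => by
        have := (le_iff_fin_four.1 h').2.2.2
        simp only [ex_apply_three] at this; omega),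
      if_neg (fun h' => by
        have := (le_iff_fin_four.1 h').1
        simp only [ex_apply_zero] at this; omega), if_pos (le_iff_fin_four.2 (by simp))]
    · have e1 : ex (ell a b c) q (emm a b c + r) 0 - ex (ell a b c) 0 (emm a b c) 0 =
          ex 0 q r 0 := by apply ex_ext <;> simp
      have e2 : ex 0 (emm a b c + q) r (ell a b c) - ex 0 (emm a b c) 0 (ell a b c) =
          ex 0 q r 0 := by apply ex_ext <;> simp
      rw [e1, e2]; ring
    · rw [dead_iff h]
      simp only [ex_apply_zero, ex_apply_one, ex_apply_two, ex_apply_three]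
      rintro (h1 | h1 | h1)
      · omega
      · exact h0 _ h1
      · exact hA (deadPair_ell_emm_of_add h h1)
    · rw [dead_iff h]
      simp only [ex_apply_zero, ex_apply_one, ex_apply_two, ex_apply_three]
      rintro (h1 | h1 | h1)
      · omega
      · exact hA (deadPair_ell_emm_of_add h h1)
      · exact h0 _ h1
  rw [mem_span_X_zero_three_iff]
  intro q r
  have := hsum _ hg q r
  rw [coeff_monomial_mul', coeff_monomial_mul', if_pos (le_iff_fin_four.2 (by simp)),
    if_neg (fun h' => by
        have := (le_iff_fin_four.1 h').1
        simp only [ex_apply_zero] at this; omega)] at this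
  have e1 : ex (ell a b c) q (emm a b c + r) 0 - ex (ell a b c) 0 (emm a b c) 0 =
          ex 0 q r 0 := by apply ex_ext <;> simp
  rwa [e1, one_mul, add_zero] at this

/-- The linear form `z₂ + z₃` is regular on the fiber cone. -/
lemma mem_definingIdeal_of_mul (h : Admissible a b c) {f : MvPolynomial (Fin 4) K}
    (hf : (X 1 + X 2) * f ∈ definingIdeal K a b c) : f ∈ definingIdeal K a b c := by
  have h1 := markedIdeal_le h
    (mem_markedIdeal_of_mul h (definingIdeal_le_markedIdeal h hf))
  by_cases hA : DeadPair a b c (ell a b c) (emm a b c)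
  · rwa [sup_eq_left.2 ((Ideal.span_singleton_le_iff_mem _).2
      (monomial_mem_definingIdeal hA))] at h1
  · obtain ⟨u, hu, v, hv, rfl⟩ := Submodule.mem_sup.1 h1
    obtain ⟨g, rfl⟩ := Ideal.mem_span_singleton'.1 hv
    rw [mul_add] at hf
    have h2 := (Ideal.add_mem_iff_right _ (Ideal.mul_mem_left _ _ hu)).1 hf
    have h3 : monomial (ex (ell a b c) 0 (emm a b c) 0) 1 * ((X 1 + X 2) * g) ∈
        definingIdeal K a b c := by
      convert h2 using 1; ring
    have hg : g ∈ Ideal.span (X '' ({0, 3} : Set (Fin 4))) := by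
      have h4 := mem_span_X_zero_three_iff.1 (mem_span_of_monomial_mul_mem h hA h3)
      refine mem_span_X_zero_three_iff.2 fun q r => ?_
      induction r generalizing q with
      | zero =>
        have := h4 (q + 1) 0
        rwa [add_mul, coeff_add, coeff_ex_X_one_mul_succ, coeff_X_mul_of_eq_zero _ (by simp),
          add_zero] at this
      | succ r ih =>
        have := h4 (q + 1) (r + 1)
        rwa [add_mul, coeff_add, coeff_ex_X_one_mul_succ, coeff_ex_X_two_mul_succ, ih,
          add_zero] at this
    refine add_mem hu ?_
    clear h3 h2 h1 hf hv
    induction hg using Submodule.span_induction with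
    | mem x hx =>
      obtain ⟨k, hk, rfl⟩ := hx
      rcases hk with rfl | rfl
      · exact monomial_ell_succ_mem h
      · exact X_three_mul_monomial_mem h (ell_pos h)
    | zero => simp
    | add x y _ _ hx hy => rw [add_mul]; exact add_mem hx hy
    | smul r x _ hx => rw [smul_eq_mul, mul_assoc]; exact Ideal.mul_mem_left _ _ hx

end

section

/-! ### The quotient by the regular element -/

section Fold

variable (K : Type*) [Field K]

/-- The endomorphism of `K[z₁, z₂, z₃, z₄]` that replaces `z₃` by `-z₂`. Its kernel is generated by
`z₂ + z₃`, so that it models the quotient by this linear form. -/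
noncomputable def fold : MvPolynomial (Fin 4) K →ₐ[K] MvPolynomial (Fin 4) K :=
  aeval ![X 0, X 1, -X 1, X 3]

variable {K}

lemma sub_fold_mem (f : MvPolynomial (Fin 4) K) :
    f - fold K f ∈ Ideal.span {(X 1 + X 2 : MvPolynomial (Fin 4) K)} := by
  rw [← Ideal.Quotient.mk_eq_mk_iff_sub_mem]
  have : (Ideal.Quotient.mkₐ K (Ideal.span {(X 1 + X 2 : MvPolynomial (Fin 4) K)})).comp (fold K) =
      Ideal.Quotient.mkₐ K _ := by
    ext k
    fin_cases k
    · simp [fold]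
    · simp [fold]
    · simp only [fold, AlgHom.comp_apply, aeval_X]
      change Ideal.Quotient.mk _ (-X 1) = Ideal.Quotient.mk _ (X 2)
      rw [Ideal.Quotient.mk_eq_mk_iff_sub_mem]
      have : (-X 1 - X 2 : MvPolynomial (Fin 4) K) = -(X 1 + X 2) := by ring
      rw [this, neg_mem_iff]
      exact Ideal.mem_span_singleton_self _
    · simp [fold]
  exact (DFunLike.congr_fun this f).symm

lemma fold_linear : fold K (X 1 + X 2) = 0 := by
  simp [fold]

lemma fold_monomial (p q r s : ℕ) : fold K (monomial (ex p q r s) 1) =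
    C ((-1) ^ r) * monomial (ex p (q + r) 0 s) 1 := by
  rw [monomial_ex, monomial_ex]
  simp only [fold, map_mul, map_pow, aeval_X, Matrix.cons_val_zero, Matrix.cons_val_one,
    Matrix.cons_val, map_neg, map_one]
  rw [neg_pow (X 1 : MvPolynomial (Fin 4) K)]
  ring

end Fold

variable {K : Type*} [Field K] {a b c : ℕ}

variable (a b c) in
/-- The exponents that `Marked` becomes when `z₃` is replaced by `-z₂`. -/
def FoldMarked (α : Fin 4 →₀ ℕ) : Prop :=
  (0 < α 0 ∧ 0 < α 3) ∨ MarkedPair a b c (α 0) (α 1) ∨ MarkedPair a b c (α 3) (α 1)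

lemma FoldMarked.mono {α β : Fin 4 →₀ ℕ} (h : FoldMarked a b c α) (hle : α ≤ β) :
    FoldMarked a b c β := by
  rw [le_iff_fin_four] at hle
  rcases h with h | h | h
  · exact Or.inl ⟨by omega, by omega⟩
  · exact Or.inr (Or.inl (h.mono hle.1 hle.2.1))
  · exact Or.inr (Or.inr (h.mono hle.2.2.2 hle.2.1))

variable (K a b c) in
/-- The monomial ideal that contains the image of `J` modulo `z₂ + z₃`. -/
noncomputable def foldIdeal : Ideal (MvPolynomial (Fin 4) K) :=
  Ideal.span ((fun s => monomial s (1 : K)) '' {α | FoldMarked a b c α})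

lemma mem_foldIdeal_iff {f : MvPolynomial (Fin 4) K} :
    f ∈ foldIdeal K a b c ↔ ∀ α, ¬ FoldMarked a b c α → coeff α f = 0 :=
  mem_span_monomial_iff fun _ _ h1 h2 => h2.mono h1

lemma fold_mem_foldIdeal (h : Admissible a b c) {f : MvPolynomial (Fin 4) K}
    (hf : f ∈ definingIdeal K a b c ⊔ Ideal.span {X 1 + X 2}) :
    fold K f ∈ foldIdeal K a b c := by
  have hle : definingIdeal K a b c ⊔ Ideal.span {X 1 + X 2} ≤
      (foldIdeal K a b c).comap (fold K) := by
    refine sup_le ((definingIdeal_le_markedIdeal h).trans ?_) ?_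
    · rw [markedIdeal, Ideal.span_le]
      rintro _ ⟨α, hα, rfl⟩
      obtain ⟨p, q, r, s, rfl⟩ := exists_ex α
      simp only [Ideal.coe_comap, Set.mem_preimage, SetLike.mem_coe]
      rw [fold_monomial]
      refine Ideal.mul_mem_left _ _ (Ideal.subset_span ⟨_, ?_, rfl⟩)
      rcases hα with h1 | h1 | h1
      · exact Or.inl h1
      · exact Or.inr (Or.inl (h1.mono le_rfl (Nat.le_add_left _ _)))
      · exact Or.inr (Or.inr (h1.mono le_rfl (Nat.le_add_right _ _)))
    · rw [Ideal.span_singleton_le_iff_mem, Ideal.mem_comap, fold_linear]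
      exact zero_mem _
  exact hle hf

lemma mem_sup_of_fold_mem (h : Admissible a b c) (hA : DeadPair a b c (ell a b c) (emm a b c))
    {f : MvPolynomial (Fin 4) K} (hf : fold K f ∈ foldIdeal K a b c) :
    f ∈ definingIdeal K a b c ⊔ Ideal.span {X 1 + X 2} := by
  have hN : ∀ {p r}, MarkedPair a b c p r → DeadPair a b c p r := fun hm =>
    hm.elim id fun hm => hA.mono hm.1 hm.2
  have hle : foldIdeal K a b c ≤ definingIdeal K a b c ⊔ Ideal.span {X 1 + X 2} := by
    rw [foldIdeal, Ideal.span_le]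
    rintro _ ⟨α, hα, rfl⟩
    obtain ⟨p, q, r, s, rfl⟩ := exists_ex α
    simp only [SetLike.mem_coe]
    rcases hα with h1 | h1 | h1
    · exact Ideal.mem_sup_left (monomial_mem_definingIdeal (dead_of_pos h h1.1 h1.2))
    · -- modulo `z₂ + z₃`, the monomial `z₁ ^ p * z₂ ^ q` is up to sign `z₁ ^ p * z₃ ^ q`
      have h2 : monomial (ex p 0 q 0) (1 : K) ∈ definingIdeal K a b c :=
        monomial_mem_definingIdeal (hN h1)
      have h3 := sub_fold_mem (monomial (ex p 0 q 0) (1 : K))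
      have h4 : fold K (monomial (ex p 0 q 0) (1 : K)) ∈
          definingIdeal K a b c ⊔ Ideal.span {X 1 + X 2} := by
        rw [← sub_sub_cancel (monomial (ex p 0 q 0) (1 : K)) (fold K _)]
        exact sub_mem (Ideal.mem_sup_left h2) (Ideal.mem_sup_right h3)
      rw [fold_monomial] at h4
      have h5 : monomial (ex p q r s) (1 : K) = monomial (ex 0 0 r s) 1 * C ((-1) ^ q) *
          (C ((-1) ^ q) * monomial (ex p (0 + q) 0 0) 1) := by
        rw [mul_assoc, ← mul_assoc (C _) (C _), ← C_mul, ← pow_add, Even.neg_one_pow ⟨q, rfl⟩, C_1,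
          one_mul, monomial_mul, ex_add]
        simp
      rw [h5]
      exact Ideal.mul_mem_left _ _ h4
    · refine Ideal.mem_sup_left (monomial_mem_definingIdeal ?_)
      exact Dead.mono (dead_ex_reverse (hN h1))
        (le_iff_fin_four.2 ⟨by simp, le_rfl, by simp, le_rfl⟩)
  rw [← sub_add_cancel f (fold K f)]
  exact add_mem (Ideal.mem_sup_right (sub_fold_mem f)) (hle hf)

/-- If the marked pairs form a single quadrant, then the quotient by `z₂ + z₃` is
`K[z₁, z₂, z₄] / (z₁ z₄, z₁ ^ i * z₂ ^ j, z₂ ^ j * z₄ ^ i)`, on which `z₁ + z₂ + z₄` is regular. -/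
lemma mem_foldIdeal_of_mul {i j : ℕ} (hi : 0 < i)
    (hN : ∀ p r, MarkedPair a b c p r ↔ i ≤ p ∧ j ≤ r) {f : MvPolynomial (Fin 4) K}
    (hf : (X 0 + X 1 + X 3) * f ∈ foldIdeal K a b c) : f ∈ foldIdeal K a b c := by
  rw [mem_foldIdeal_iff] at hf ⊢
  have hunm : ∀ {p q r s}, ¬ FoldMarked a b c (ex p q r s) ↔
      ((s = 0 ∧ (p < i ∨ q < j)) ∨ (p = 0 ∧ (s < i ∨ q < j))) := by
    intro p q r s
    simp only [FoldMarked, ex_apply_zero, ex_apply_one, ex_apply_three, hN]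
    omega
  have h1 : ∀ p q r, p < i → coeff (ex p q r 0) f = 0 := by
    intro p
    induction p with
    | zero =>
      intro q r hp
      have := hf (ex 0 (q + 1) r 0) (hunm.2 (by omega))
      rwa [add_mul, add_mul, coeff_add, coeff_add, coeff_ex_X_one_mul_succ,
        coeff_X_mul_of_eq_zero _ (by simp), coeff_X_mul_of_eq_zero _ (by simp), add_zero,
        zero_add] at this
    | succ p ih =>
      intro q r hp
      have := hf (ex (p + 1) (q + 1) r 0) (hunm.2 (by omega))
      rwa [add_mul, add_mul, coeff_add, coeff_add, coeff_ex_X_one_mul_succ,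
        coeff_ex_X_zero_mul_succ, coeff_X_mul_of_eq_zero _ (by simp), ih _ _ (by omega), add_zero,
        zero_add] at this
  have h2 : ∀ q p r, q < j → coeff (ex p q r 0) f = 0 := by
    intro q
    induction q with
    | zero =>
      intro p r hq
      have := hf (ex (p + 1) 0 r 0) (hunm.2 (by omega))
      rwa [add_mul, add_mul, coeff_add, coeff_add, coeff_ex_X_zero_mul_succ,
        coeff_X_mul_of_eq_zero _ (by simp), coeff_X_mul_of_eq_zero _ (by simp), add_zero,
        add_zero] at this
    | succ q ih =>
      intro p r hq
      have := hf (ex (p + 1) (q + 1) r 0) (hunm.2 (by omega))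
      rwa [add_mul, add_mul, coeff_add, coeff_add, coeff_ex_X_one_mul_succ,
        coeff_ex_X_zero_mul_succ, coeff_X_mul_of_eq_zero _ (by simp), ih _ _ (by omega), add_zero,
        add_zero] at this
  have h3 : ∀ s q r, s < i → coeff (ex 0 q r s) f = 0 := by
    intro s
    induction s with
    | zero => exact fun q r hs => h1 0 q r hi
    | succ s ih =>
      intro q r hp
      have := hf (ex 0 (q + 1) r (s + 1)) (hunm.2 (by omega))
      rwa [add_mul, add_mul, coeff_add, coeff_add, coeff_ex_X_one_mul_succ,
        coeff_ex_X_three_mul_succ, coeff_X_mul_of_eq_zero _ (by simp), ih _ _ (by omega), add_zero,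
        zero_add] at this
  have h4 : ∀ q s r, q < j → coeff (ex 0 q r s) f = 0 := by
    intro q
    induction q with
    | zero =>
      intro s r hq
      have := hf (ex 0 0 r (s + 1)) (hunm.2 (by omega))
      rwa [add_mul, add_mul, coeff_add, coeff_add, coeff_ex_X_three_mul_succ,
        coeff_X_mul_of_eq_zero _ (by simp), coeff_X_mul_of_eq_zero _ (by simp), zero_add,
        zero_add] at this
    | succ q ih =>
      intro s r hq
      have := hf (ex 0 (q + 1) r (s + 1)) (hunm.2 (by omega))
      rwa [add_mul, add_mul, coeff_add, coeff_add, coeff_ex_X_one_mul_succ,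
        coeff_ex_X_three_mul_succ, coeff_X_mul_of_eq_zero _ (by simp), ih _ _ (by omega), zero_add,
        zero_add] at this
  intro α hα
  obtain ⟨p, q, r, s, rfl⟩ := exists_ex α
  rcases hunm.1 hα with ⟨rfl, hp | hq⟩ | ⟨rfl, hs | hq⟩
  · exact h1 p q r hp
  · exact h2 q p r hq
  · exact h3 s q r hs
  · exact h4 q s r hq

/-! ### The socle modulo the regular element -/

lemma X_mul_mem_of (w : MvPolynomial (Fin 4) K)
    (h0 : X 0 * w ∈ definingIdeal K a b c) (h2 : X 2 * w ∈ definingIdeal K a b c)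
    (h3 : X 3 * w ∈ definingIdeal K a b c) (k : Fin 4) :
    X k * w ∈ definingIdeal K a b c ⊔ Ideal.span {X 1 + X 2} := by
  fin_cases k
  · exact Ideal.mem_sup_left h0
  · have : X 1 * w = w * (X 1 + X 2) - X 2 * w := by ring
    simp only [Fin.mk_one]
    rw [this]
    exact sub_mem (Ideal.mem_sup_right (Ideal.mul_mem_left _ _ (Ideal.mem_span_singleton_self _)))
      (Ideal.mem_sup_left h2)
  · exact Ideal.mem_sup_left h2
  · exact Ideal.mem_sup_left h3

lemma monomial_not_mem (h : Admissible a b c) {p r : ℕ} (hpr : ¬ MarkedPair a b c p r) :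
    monomial (ex p 0 r 0) (1 : K) ∉ definingIdeal K a b c ⊔ Ideal.span {X 1 + X 2} := by
  intro hmem
  have h1 := fold_mem_foldIdeal h hmem
  rw [fold_monomial, mem_foldIdeal_iff] at h1
  have h2 := h1 (ex p (0 + r) 0 0) (by
    have h0 : ¬ MarkedPair a b c 0 r := fun ht => (ht.pos h).false
    simp [FoldMarked, hpr, h0])
  rw [C_mul_monomial, coeff_monomial, if_pos rfl] at h2
  simp at h2

/-- A corner of the staircase of live monomials in `z₁`, `z₃` is a socle element modulo
`z₂ + z₃`. -/
lemma exists_socle_of_corner (h : Admissible a b c) {p r : ℕ} (hp : 0 < p)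
    (hpr : ¬ MarkedPair a b c p r)
    (h1 : X 0 * monomial (ex p 0 r 0) (1 : K) ∈ definingIdeal K a b c)
    (h3 : X 2 * monomial (ex p 0 r 0) (1 : K) ∈ definingIdeal K a b c) :
    ∃ w, (∀ k, X k * w ∈ definingIdeal K a b c ⊔ Ideal.span {X 1 + X 2}) ∧
      w ∉ definingIdeal K a b c ⊔ Ideal.span {X 1 + X 2} :=
  ⟨_, X_mul_mem_of _ h1 h3 (X_three_mul_monomial_mem h hp), monomial_not_mem h hpr⟩

lemma exists_last_alive {p₀ p₁ r : ℕ} (h0 : ¬ DeadPair a b c p₀ r) (h1 : DeadPair a b c p₁ r) :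
    ∃ p, p₀ ≤ p ∧ ¬ DeadPair a b c p r ∧ DeadPair a b c (p + 1) r := by
  classical
  have hex : ∃ p, DeadPair a b c p r := ⟨p₁, h1⟩
  have hlt : p₀ < Nat.find hex := by
    by_contra! hle
    exact h0 ((Nat.find_spec hex).mono hle le_rfl)
  refine ⟨Nat.find hex - 1, by omega, Nat.find_min hex (by omega), ?_⟩
  rw [Nat.sub_add_cancel (by omega)]
  exact Nat.find_spec hex

/-- Unless `J` is generated by the three base monomials, `F(I) / (z₂ + z₃)` has a nonzero socle. -/
lemma exists_socle (h : Admissible a b c) {i j : ℕ} (hl : IsLeast (posetS a b c) (i, j))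
    (hne : ¬ (DeadPair a b c (ell a b c) (emm a b c) ∧ minPairs a b c = {(i, j)})) :
    ∃ w : MvPolynomial (Fin 4) K,
      (∀ k, X k * w ∈ definingIdeal K a b c ⊔ Ideal.span {X 1 + X 2}) ∧
      w ∉ definingIdeal K a b c ⊔ Ideal.span {X 1 + X 2} := by
  have hij := deadPair_of_mem_posetS h hl.1
  have hmul0 : ∀ {p r}, DeadPair a b c (p + 1) r →
      X 0 * monomial (ex p 0 r 0) (1 : K) ∈ definingIdeal K a b c := fun {p r} hd => by
    have : X 0 * monomial (ex p 0 r 0) (1 : K) = monomial (ex (p + 1) 0 r 0) 1 := by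
      rw [monomial_ex, monomial_ex]; ring
    rw [this]
    exact monomial_mem_definingIdeal hd
  have hmul2 : ∀ {p r}, X 2 * monomial (ex p 0 r 0) (1 : K) = monomial (ex p 0 (r + 1) 0) 1 := by
    intro p r
    rw [monomial_ex, monomial_ex]; ring
  have hjm := lt_emm_of_isLeast h hl
  by_cases hA : DeadPair a b c (ell a b c) (emm a b c)
  · -- a further minimal dead monomial `z₁ ^ p * z₃ ^ (r + 1)` gives a corner in the row `r`
    have hM : minPairs a b c ≠ {(i, j)} := fun hM => hne ⟨hA, hM⟩
    obtain ⟨⟨p, r⟩, hp, hpne⟩ : ∃ x ∈ minPairs a b c, x ≠ (i, j) := by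
      by_contra! hall
      exact hM (Set.eq_singleton_iff_unique_mem.2 ⟨mem_minPairs_of_isLeast h hl, hall⟩)
    have h1 := DeadPair.le_of_isLeast h hl hp.1.1
    have hnle : ¬ (i, j) ≤ (p, r) := fun hle =>
      hpne (isAntichain_minPairs.eq (mem_minPairs_of_isLeast h hl) hp hle).symm
    have h2 : ¬ (i ≤ p ∧ j ≤ r) := hnle
    simp only at h1
    obtain ⟨r, rfl⟩ : ∃ r', r = r' + 1 := ⟨r - 1, by omega⟩
    have h3 : ¬ DeadPair a b c p r := fun hd => by
      have := (hp.1.2 (y := (p, r)) hd ⟨le_rfl, Nat.le_succ r⟩).2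
      simp at this
    obtain ⟨p', hpp', h4, h5⟩ := exists_last_alive h3 (hij.mono le_rfl (by omega : j ≤ r))
    refine exists_socle_of_corner h (p := p') (r := r) (by omega) ?_ (hmul0 h5) ?_
    · rintro (hd | hd)
      · exact h4 hd
      · exact h4 (hA.mono hd.1 hd.2)
    · rw [hmul2]
      exact monomial_mem_definingIdeal (DeadPair.mono hp.1.1 hpp' le_rfl)
  · obtain ⟨m, hm⟩ : ∃ m, emm a b c = m + 1 := ⟨emm a b c - 1, by omega⟩
    have hbinom : binom K a b c = X 2 * monomial (ex (ell a b c) 0 m 0) 1 -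
        X 1 * monomial (ex 0 m 0 (ell a b c)) 1 := by
      rw [binom_eq, hm]
      simp only [monomial_ex]
      ring
    have hnm : ∀ {p}, ¬ DeadPair a b c p m → ¬ MarkedPair a b c p m := fun hd => by
      rintro (h' | h')
      · exact hd h'
      · have := h'.2
        omega
    have hℓ := ell_pos h
    have hℓm : ¬ DeadPair a b c (ell a b c) m := fun hd =>
      hA (hd.mono le_rfl (by omega))
    by_cases hd : DeadPair a b c (ell a b c + 1) m
    · -- modulo `J`, `z₃` times the first summand of `w` equals `z₂` times the second one, so that
      -- `w` behaves like `z₂ + z₃` times the fraction `z₁ ^ ℓ * z₃ ^ m / (z₂ * z₃)`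
      refine ⟨monomial (ex (ell a b c) 0 m 0) 1 + monomial (ex 0 m 0 (ell a b c)) 1,
        fun k => ?_, fun hmem => ?_⟩
      · have hθ : ∀ f : MvPolynomial (Fin 4) K, f * (X 1 + X 2) ∈
            definingIdeal K a b c ⊔ Ideal.span {X 1 + X 2} := fun f =>
          Ideal.mem_sup_right (Ideal.mul_mem_left _ _ (Ideal.mem_span_singleton_self _))
        have hB : binom K a b c ∈ definingIdeal K a b c ⊔ Ideal.span {X 1 + X 2} :=
          Ideal.mem_sup_left (binom_mem_definingIdeal h)
        fin_cases k
        · simp only [Fin.zero_eta, mul_add]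
          exact Ideal.mem_sup_left (add_mem (hmul0 hd) (X_zero_mul_monomial_mem h hℓ))
        · have : X 1 * (monomial (ex (ell a b c) 0 m 0) (1 : K) +
              monomial (ex 0 m 0 (ell a b c)) 1) =
              monomial (ex (ell a b c) 0 m 0) 1 * (X 1 + X 2) - binom K a b c := by
            rw [hbinom]; ring
          simp only [Fin.mk_one]
          rw [this]
          exact sub_mem (hθ _) hB
        · have : X 2 * (monomial (ex (ell a b c) 0 m 0) (1 : K) +
              monomial (ex 0 m 0 (ell a b c)) 1) =
              monomial (ex 0 m 0 (ell a b c)) 1 * (X 1 + X 2) + binom K a b c := by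
            rw [hbinom]; ring
          simp only [Fin.reduceFinMk]
          rw [this]
          exact add_mem (hθ _) hB
        · simp only [Fin.reduceFinMk, mul_add]
          refine Ideal.mem_sup_left (add_mem (X_three_mul_monomial_mem h hℓ) ?_)
          have : X 3 * monomial (ex 0 m 0 (ell a b c)) (1 : K) =
              monomial (ex 0 m 0 (ell a b c + 1)) 1 := by
            simp only [monomial_ex]; ring
          rw [this]
          exact monomial_mem_definingIdeal (dead_ex_reverse hd)
      · have h1 := fold_mem_foldIdeal h hmem
        rw [map_add, fold_monomial, fold_monomial, mem_foldIdeal_iff] at h1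
        have h2 := h1 (ex (ell a b c) (0 + m) 0 0) (by
          have h0 : ¬ MarkedPair a b c 0 m := fun ht => (ht.pos h).false
          simp [FoldMarked, hnm hℓm, h0])
        have h3 : ex 0 (m + 0) 0 (ell a b c) ≠ ex (ell a b c) (0 + m) 0 0 := fun heq => by
          have := congrArg (fun α => α 0) heq
          simp only [ex_apply_zero] at this
          omega
        rw [C_mul_monomial, C_mul_monomial, coeff_add, coeff_monomial, coeff_monomial, if_pos rfl,
          if_neg h3] at h2
        simp at h2
    · obtain ⟨p', hpp', h4, h5⟩ := exists_last_alive hd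
        (hij.mono (le_refl i) (by omega : j ≤ m))
      refine exists_socle_of_corner h (p := p') (r := m) (by omega) (hnm h4) (hmul0 h5) ?_
      rw [hmul2, ← hm]
      refine Ideal.mem_of_dvd _ ?_ (monomial_ell_succ_mem h)
      rw [X, monomial_mul, mul_one, monomial_dvd_monomial]
      refine ⟨Or.inr (le_iff_fin_four.2 ⟨?_, by simp, by simp, by simp⟩), one_dvd _⟩
      simp
      omega

end

/-! ### Dimension and depth of the fiber cone -/

section Quotient

variable {K : Type*} [Field K] {a b c : ℕ} {R : Type*} [CommRing R]
  {π : MvPolynomial (Fin 4) K →+* R}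

lemma map_mem_span_singleton_iff (hπ : Function.Surjective π)
    (hker : RingHom.ker π = definingIdeal K a b c) {f θ : MvPolynomial (Fin 4) K} :
    π f ∈ Ideal.span {π θ} ↔ f ∈ definingIdeal K a b c ⊔ Ideal.span {θ} := by
  rw [← hker, sup_comm, ← Set.image_singleton, ← Ideal.map_span, ← Ideal.mem_comap,
    Ideal.comap_map_of_surjective π hπ]
  rfl

/-- The fiber cone is two-dimensional: `z₁ z₄` and `z₁ ^ i * z₃ ^ j + z₂ ^ j * z₄ ^ i`, which lie in
`J`, form a regular sequence on the polynomial ring, and `K[z₂, z₃]` is a quotient. -/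
lemma ringKrullDim_eq_two (h : Admissible a b c) (hπ : Function.Surjective π)
    (hker : RingHom.ker π = definingIdeal K a b c) : ringKrullDim R = 2 := by
  have hdim : ∀ n : ℕ, ringKrullDim (MvPolynomial (Fin n) K) = n := fun n => by
    rw [ringKrullDim_of_isNoetherianRing, ringKrullDim_eq_zero_of_field]
    simp
  apply le_antisymm
  · obtain ⟨i, j, hl⟩ := exists_isLeast_posetS h
    have hij := deadPair_of_mem_posetS h hl.1
    obtain ⟨hi, hj, -⟩ := (mem_posetS_iff h).1 hl.1
    set g : MvPolynomial (Fin 4) K := X 0 ^ i * X 2 ^ j + X 1 ^ j * X 3 ^ i with hg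
    have hgJ : π g = 0 := by
      rw [← RingHom.mem_ker, hker]
      have : g = monomial (ex i 0 j 0) 1 + monomial (ex 0 j 0 i) 1 := by
        rw [monomial_ex, monomial_ex]; simp [hg]
      rw [this]
      exact add_mem (monomial_mem_definingIdeal hij)
        (monomial_mem_definingIdeal (dead_ex_reverse hij))
    have h14 : π (X 0 * X 3) = 0 := by
      rw [← RingHom.mem_ker, hker]
      have : (X 0 * X 3 : MvPolynomial (Fin 4) K) = monomial (ex 1 0 0 1) 1 := by
        rw [monomial_ex]; simp
      rw [this]
      exact monomial_mem_definingIdeal (dead_of_pos h (by simp) (by simp))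
    have hX0 : ¬ (X 0 : MvPolynomial (Fin 4) K) ∣ g := fun hdvd => by
      have := map_dvd (aeval (![0, 1, 1, 1] : Fin 4 → K)) hdvd
      simp [hg, hi.ne'] at this
    have hX3 : ¬ (X 3 : MvPolynomial (Fin 4) K) ∣ g := fun hdvd => by
      have := map_dvd (aeval (![1, 1, 1, 0] : Fin 4 → K)) hdvd
      simp [hg, hi.ne'] at this
    have h1 : ringKrullDim (MvPolynomial (Fin 4) K ⧸ Ideal.span {(X 0 * X 3 :
        MvPolynomial (Fin 4) K)}) + 1 ≤ 4 := by
      have := ringKrullDim_quotient_succ_le_of_nonZeroDivisor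
        (r := (X 0 * X 3 : MvPolynomial (Fin 4) K))
        (mem_nonZeroDivisors_of_ne_zero (mul_ne_zero (X_ne_zero _) (X_ne_zero _)))
      rwa [hdim] at this
    have hle : Ideal.span {(X 0 * X 3 : MvPolynomial (Fin 4) K)} ≤ RingHom.ker π := by
      rwa [Ideal.span_singleton_le_iff_mem, RingHom.mem_ker]
    have h2 := ringKrullDim_succ_le_of_surjective
      (Ideal.Quotient.lift (Ideal.span {(X 0 * X 3 : MvPolynomial (Fin 4) K)}) π hle)
      (Ideal.Quotient.lift_surjective_of_surjective _ _ hπ) (r := Ideal.Quotient.mk _ g) (by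
        rw [mem_nonZeroDivisors_iff_right]
        intro y hy
        obtain ⟨y, rfl⟩ := Ideal.Quotient.mk_surjective y
        rw [← map_mul, Ideal.Quotient.eq_zero_iff_mem, Ideal.mem_span_singleton] at hy
        rw [Ideal.Quotient.eq_zero_iff_mem, Ideal.mem_span_singleton]
        obtain ⟨y, rfl⟩ := (X_prime.dvd_or_dvd ((dvd_mul_right (X 0) (X 3)).trans hy)).resolve_right
          hX0
        rw [mul_assoc] at hy
        exact mul_dvd_mul_left _ ((X_prime.dvd_or_dvd
          ((mul_dvd_mul_iff_left (X_ne_zero _)).1 hy)).resolve_right hX3)) hgJ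
    have h3 : ringKrullDim R + 2 ≤ 4 := by
      calc ringKrullDim R + 2 = ringKrullDim R + 1 + 1 := by rw [add_assoc]; rfl
        _ ≤ _ := (add_le_add h2 le_rfl).trans h1
    generalize ringKrullDim R = n at h3
    induction n with
    | bot => exact bot_le
    | coe n =>
      induction n with
      | top => exact absurd h3 (by decide)
      | coe n =>
        have h4 : (((n : ℕ∞) + 2 : ℕ∞) : WithBot ℕ∞) ≤ ((4 : ℕ∞) : WithBot ℕ∞) := h3
        have h5 : n + 2 ≤ 4 := by exact_mod_cast WithBot.coe_le_coe.1 h4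
        have h6 : (n : ℕ∞) ≤ 2 := by exact_mod_cast (by omega : n ≤ 2)
        exact WithBot.coe_le_coe.2 h6
  · set ψ : MvPolynomial (Fin 4) K →ₐ[K] MvPolynomial (Fin 2) K := aeval ![0, X 0, X 1, 0] with hψ
    have hle : RingHom.ker π ≤ RingHom.ker
        (ψ : MvPolynomial (Fin 4) K →+* MvPolynomial (Fin 2) K) := by
      rw [hker]
      refine (definingIdeal_le_markedIdeal h).trans ?_
      rw [markedIdeal, Ideal.span_le]
      rintro _ ⟨α, hα, rfl⟩
      obtain ⟨p, q, r, s, rfl⟩ := exists_ex α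
      have hps : p ≠ 0 ∨ s ≠ 0 := by
        rcases hα with h1 | h1 | h1
        · exact Or.inl h1.1.ne'
        · exact Or.inl (h1.pos h).ne'
        · exact Or.inr (h1.pos h).ne'
      simp only [SetLike.mem_coe, RingHom.mem_ker, RingHom.coe_coe]
      rw [monomial_ex, hψ]
      rcases hps with hp | hs <;> simp [*]
    have hsurj : Function.Surjective (ψ : MvPolynomial (Fin 4) K →+* MvPolynomial (Fin 2) K) := by
      have : ψ.comp (rename ![1, 2]) = AlgHom.id K _ := by
        ext k
        fin_cases k <;> simp [hψ]
      exact fun f => ⟨rename ![1, 2] f, DFunLike.congr_fun this f⟩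
    have := ringKrullDim_le_of_surjective (RingHom.liftOfSurjective π hπ ⟨_, hle⟩) (fun f => by
      obtain ⟨g, hg⟩ := hsurj f
      exact ⟨π g, by rw [RingHom.liftOfRightInverse_comp_apply]; exact hg⟩)
    rwa [hdim] at this

lemma one_not_mem (h : Admissible a b c) :
    (1 : MvPolynomial (Fin 4) K) ∉
      definingIdeal K a b c ⊔ Ideal.span (Set.range (X : Fin 4 → MvPolynomial (Fin 4) K)) := by
  have hle : definingIdeal K a b c ⊔
      Ideal.span (Set.range (X : Fin 4 → MvPolynomial (Fin 4) K)) ≤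
      RingHom.ker (constantCoeff : MvPolynomial (Fin 4) K →+* K) := by
    refine sup_le ((definingIdeal_le_markedIdeal h).trans ?_) ?_
    · intro f hf
      refine mem_markedIdeal_iff.1 hf 0 ?_
      have h0 : ∀ t, ¬ MarkedPair a b c 0 t := fun t ht => (ht.pos h).false
      simp [Marked, h0]
    · rw [Ideal.span_le]
      rintro _ ⟨k, rfl⟩
      simp
  intro h1
  simpa using hle h1

variable {𝔞 : Ideal R}

lemma ideal_ne_top (h : Admissible a b c) (hker : RingHom.ker π = definingIdeal K a b c)
    (h𝔞 : ∀ x, x ∈ 𝔞 ↔ ∃ f ∈ Ideal.span (Set.range (X : Fin 4 → MvPolynomial (Fin 4) K)),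
      π f = x) : 𝔞 ≠ ⊤ := by
  intro htop
  obtain ⟨f, hf, hf1⟩ := (h𝔞 1).1 (htop ▸ Submodule.mem_top)
  refine one_not_mem (K := K) h ?_
  rw [← sub_add_cancel 1 f]
  refine add_mem (Ideal.mem_sup_left ?_) (Ideal.mem_sup_right hf)
  rw [← hker, RingHom.mem_ker, map_sub, hf1, map_one, sub_self]

lemma linear_regular (h : Admissible a b c) (hπ : Function.Surjective π)
    (hker : RingHom.ker π = definingIdeal K a b c) (z : R) (hz : π (X 1 + X 2) * z = 0) :
    z = 0 := by
  obtain ⟨f, rfl⟩ := hπ z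
  rw [← map_mul, ← RingHom.mem_ker, hker] at hz
  rw [← RingHom.mem_ker, hker]
  exact mem_definingIdeal_of_mul h hz

lemma depthIn_eq_two_of (h : Admissible a b c) (hπ : Function.Surjective π)
    (hker : RingHom.ker π = definingIdeal K a b c)
    (h𝔞 : ∀ x, x ∈ 𝔞 ↔ ∃ f ∈ Ideal.span (Set.range (X : Fin 4 → MvPolynomial (Fin 4) K)),
      π f = x) {i j : ℕ} (hl : IsLeast (posetS a b c) (i, j))
    (hA : DeadPair a b c (ell a b c) (emm a b c)) (hM : minPairs a b c = {(i, j)}) :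
    depthIn 𝔞 = 2 := by
  have hX : ∀ k, π (X k) ∈ 𝔞 := fun k => (h𝔞 _).2 ⟨X k, Ideal.subset_span ⟨k, rfl⟩, rfl⟩
  have hN : ∀ p r, MarkedPair a b c p r ↔ i ≤ p ∧ j ≤ r := by
    intro p r
    constructor
    · intro hm
      have hd : DeadPair a b c p r := hm.elim id fun hm => hA.mono hm.1 hm.2
      obtain ⟨q, hq, hmin⟩ := exists_minimal_le_of_wellFoundedLT
        (fun p : ℕ × ℕ => DeadPair a b c p.1 p.2) (p, r) hd
      have : q ∈ minPairs a b c := ⟨hmin, Or.inl hA⟩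
      rw [hM, Set.mem_singleton_iff] at this
      subst this
      exact hq
    · exact fun hp => Or.inl ((deadPair_of_mem_posetS h hl.1).mono hp.1 hp.2)
  have hi := ((mem_posetS_iff h).1 hl.1).1
  refine depthIn_eq_two (ringKrullDim_eq_two h hπ hker) (ideal_ne_top h hker h𝔞)
    (x := π (X 1 + X 2)) (y := π (X 0 + X 1 + X 3)) ?_ ?_ (linear_regular h hπ hker)
    fun z hz => ?_
  · rw [map_add]
    exact add_mem (hX 1) (hX 2)
  · rw [map_add, map_add]
    exact add_mem (add_mem (hX 0) (hX 1)) (hX 3)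
  · obtain ⟨f, rfl⟩ := hπ z
    rw [← map_mul, map_mem_span_singleton_iff hπ hker] at hz
    rw [map_mem_span_singleton_iff hπ hker]
    refine mem_sup_of_fold_mem h hA (mem_foldIdeal_of_mul hi hN ?_)
    have := fold_mem_foldIdeal h hz
    rwa [map_mul, show fold K (X 0 + X 1 + X 3) = X 0 + X 1 + X 3 by simp [fold]] at this

lemma depthIn_eq_one_of (h : Admissible a b c) (hπ : Function.Surjective π)
    (hker : RingHom.ker π = definingIdeal K a b c)
    (h𝔞 : ∀ x, x ∈ 𝔞 ↔ ∃ f ∈ Ideal.span (Set.range (X : Fin 4 → MvPolynomial (Fin 4) K)),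
      π f = x) {i j : ℕ} (hl : IsLeast (posetS a b c) (i, j))
    (hne : ¬ (DeadPair a b c (ell a b c) (emm a b c) ∧ minPairs a b c = {(i, j)})) :
    depthIn 𝔞 = 1 := by
  have hX : ∀ k, π (X k) ∈ 𝔞 := fun k => (h𝔞 _).2 ⟨X k, Ideal.subset_span ⟨k, rfl⟩, rfl⟩
  obtain ⟨w, hw, hw'⟩ := exists_socle (K := K) h hl hne
  refine depthIn_eq_one (ideal_ne_top h hker h𝔞) (θ := π (X 1 + X 2)) (w := π w) ?_
    (linear_regular h hπ hker) ?_ fun z hz => ?_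
  · rw [map_add]
    exact add_mem (hX 1) (hX 2)
  · rwa [map_mem_span_singleton_iff hπ hker]
  · obtain ⟨f, hf, rfl⟩ := (h𝔞 z).1 hz
    rw [← map_mul, map_mem_span_singleton_iff hπ hker]
    clear hz
    induction hf using Submodule.span_induction with
    | mem x hx => obtain ⟨k, rfl⟩ := hx; exact hw k
    | zero => simp
    | add x y _ _ hx hy => rw [add_mul]; exact add_mem hx hy
    | smul r x _ hx => rw [smul_eq_mul, mul_assoc]; exact Ideal.mul_mem_left _ _ hx

end Quotient

section Main

variable {K : Type*} [Field K] {a b c i j : ℕ}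

lemma mem_irrelevant_iff_ringHom (x : FiberCone (maxIdeal K) (symmIdeal K a b c)) :
    x ∈ FiberCone.irrelevant (maxIdeal K) (symmIdeal K a b c) ↔
      ∃ f ∈ Ideal.span (Set.range (X : Fin 4 → MvPolynomial (Fin 4) K)),
        (presentation K a b c).toRingHom f = x := mem_irrelevant_iff K a b c

lemma fiberCone_dim (h : Admissible a b c) :
    ringKrullDim (FiberCone (maxIdeal K) (symmIdeal K a b c)) = 2 :=
  ringKrullDim_eq_two (R := FiberCone (maxIdeal K) (symmIdeal K a b c)) h
    (π := (presentation K a b c).toRingHom) (presentation_surjective K a b c) rfl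

lemma fiberCone_depth_eq_two (h : Admissible a b c) (hl : IsLeast (posetS a b c) (i, j))
    (hA : DeadPair a b c (ell a b c) (emm a b c)) (hM : minPairs a b c = {(i, j)}) :
    FiberCone.depth (maxIdeal K) (symmIdeal K a b c) = 2 :=
  depthIn_eq_two_of h (π := (presentation K a b c).toRingHom)
    (presentation_surjective K a b c) rfl mem_irrelevant_iff_ringHom hl hA hM

lemma fiberCone_depth_eq_one (h : Admissible a b c) (hl : IsLeast (posetS a b c) (i, j))
    (hne : ¬ (DeadPair a b c (ell a b c) (emm a b c) ∧ minPairs a b c = {(i, j)})) :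
    FiberCone.depth (maxIdeal K) (symmIdeal K a b c) = 1 :=
  depthIn_eq_one_of h (π := (presentation K a b c).toRingHom)
    (presentation_surjective K a b c) rfl mem_irrelevant_iff_ringHom hl hne

lemma caseI_iff (h : Admissible a b c) (hl : IsLeast (posetS a b c) (i, j)) :
    CaseI K a b c i j ↔
      DeadPair a b c (ell a b c) (emm a b c) ∧ minPairs a b c = {(i, j)} := by
  classical
  refine ⟨fun hI => ?_, fun hAM => caseI_of K h hAM.1 hAM.2⟩
  have hij := deadPair_of_mem_posetS h hl.1
  have hspan : Ideal.span ((fun s => monomial s (1 : K)) '' genExps {(i, j)}) =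
      definingIdeal K a b c := by
    rw [← baseGens_eq]; exact hI.1
  have key : ∀ {f : MvPolynomial (Fin 4) K} {p r}, f ∈ definingIdeal K a b c → 0 < p →
      coeff (ex p 0 r 0) f ≠ 0 → i ≤ p ∧ j ≤ r := by
    intro f p r hf hp hcoeff
    rw [← hspan, mem_ideal_span_monomial_image] at hf
    obtain ⟨γ, hγ, hle⟩ := hf _ (mem_support_iff.2 hcoeff)
    rw [le_iff_fin_four] at hle
    have hi := ((mem_posetS_iff h).1 hl.1).1
    rcases hγ with rfl | ⟨q, hq, rfl | rfl⟩ <;>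
      simp only [ex_apply_zero, ex_apply_one, ex_apply_two, ex_apply_three] at hle
    · omega
    · rw [Set.mem_singleton_iff] at hq
      subst hq
      exact ⟨hle.1, hle.2.2.1⟩
    · rw [Set.mem_singleton_iff] at hq
      subst hq
      simp only at hle
      omega
  constructor
  · have hℓ := ell_pos h
    have hne : ex 0 (emm a b c) 0 (ell a b c) ≠ ex (ell a b c) 0 (emm a b c) 0 := fun heq => by
      have := congrArg (fun α => α 0) heq
      simp only [ex_apply_zero] at this
      omega
    have := key (binom_mem_definingIdeal (K := K) h) (p := ell a b c) (r := emm a b c) hℓ (by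
      rw [binom_eq, coeff_sub, coeff_monomial, coeff_monomial, if_pos rfl, if_neg hne]
      simp)
    exact hij.mono this.1 this.2
  · refine Set.eq_singleton_iff_unique_mem.2 ⟨mem_minPairs_of_isLeast h hl, fun q hq => ?_⟩
    have := key (r := q.2) (monomial_mem_definingIdeal (K := K) hq.1.1)
      (pos_of_mem_minPairs h q hq).1 (by simp)
    exact (isAntichain_minPairs.eq (mem_minPairs_of_isLeast h hl) hq this).symm

lemma isCohenMacaulay_iff (h : Admissible a b c) (hl : IsLeast (posetS a b c) (i, j)) :
    FiberCone.IsCohenMacaulay (maxIdeal K) (symmIdeal K a b c) ↔ CaseI K a b c i j := by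
  rw [FiberCone.IsCohenMacaulay, fiberCone_dim h, caseI_iff h hl]
  constructor
  · intro hcm
    by_contra hne
    rw [fiberCone_depth_eq_one h hl hne] at hcm
    exact absurd hcm (by decide)
  · rintro ⟨hA, hM⟩
    rw [fiberCone_depth_eq_two h hl hA hM]
    rfl

/-! ### Each case occurs -/

lemma minPairs_eq_singleton (h : Admissible a b c) (hl : IsLeast (posetS a b c) (i, j))
    (hle : ∀ p r, DeadPair a b c p r → i ≤ p ∧ j ≤ r) : minPairs a b c = {(i, j)} :=
  Set.eq_singleton_iff_unique_mem.2 ⟨mem_minPairs_of_isLeast h hl, fun q hq =>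
    (isAntichain_minPairs.eq (mem_minPairs_of_isLeast h hl) hq (hle q.1 q.2 hq.1.1)).symm⟩

lemma minPairs_ne_singleton {p r : ℕ} (hp : p < i) (hd : DeadPair a b c p r)
    (hA : DeadPair a b c (ell a b c) (emm a b c) ∨ r < emm a b c) :
    minPairs a b c ≠ {(i, j)} := by
  intro hM
  obtain ⟨q, hq, hmin⟩ := exists_minimal_le_of_wellFoundedLT
    (fun p : ℕ × ℕ => DeadPair a b c p.1 p.2) (p, r) hd
  have h1 : q.1 ≤ p := hq.1
  have h2 : q.2 ≤ r := hq.2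
  have hmem : q ∈ minPairs a b c := ⟨hmin, hA.imp id fun hr hle => by
    have : emm a b c ≤ q.2 := hle.2
    omega⟩
  rw [hM, Set.mem_singleton_iff] at hmem
  subst hmem
  simp only at h1
  omega

variable (K)

lemma exists_caseI : ∃ a b c i j : ℕ, Admissible a b c ∧ IsLeast (posetS a b c) (i, j) ∧
    CaseI K a b c i j := by
  have h : Admissible 1 2 4 := by norm_num [Admissible]
  obtain ⟨i, j, hl⟩ := exists_isLeast_posetS h
  have h11 : (1, 1) ∈ posetS 1 2 4 := (mem_posetS_iff h).2 (by norm_num)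
  have hi : i ≤ 1 := (hl.2 h11).1
  have hA : DeadPair 1 2 4 (ell 1 2 4) (emm 1 2 4) :=
    (deadPair_of_mem_posetS h h11).mono (by norm_num [ell]) (by norm_num [emm])
  refine ⟨1, 2, 4, i, j, h, hl, caseI_of K h hA (minPairs_eq_singleton h hl fun p r hd => ?_)⟩
  have := hd.le_of_isLeast h hl
  omega

lemma exists_caseII : ∃ a b c i j : ℕ, Admissible a b c ∧ IsLeast (posetS a b c) (i, j) ∧
    CaseII K a b c i j := by
  have h : Admissible 5 12 18 := by norm_num [Admissible]
  obtain ⟨i, j, hl⟩ := exists_isLeast_posetS h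
  have h43 : (4, 3) ∈ posetS 5 12 18 := (mem_posetS_iff h).2 (by norm_num)
  have hA : DeadPair 5 12 18 (ell 5 12 18) (emm 5 12 18) :=
    (deadPair_of_mem_posetS h h43).mono (by norm_num [ell]) (by norm_num [emm])
  have h34 : DeadPair 5 12 18 3 4 :=
    Dominated.deadPair h ⟨1, 3, by norm_num, by norm_num, by norm_num, by norm_num⟩
  have hi : 3 < i := by
    by_contra! hi
    obtain ⟨h1, h2, h3, h4⟩ := (mem_posetS_iff h).1 hl.1
    interval_cases i <;> omega
  exact ⟨5, 12, 18, i, j, h, hl, caseII_of K h hl hA (minPairs_ne_singleton hi h34 (Or.inl hA))⟩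

lemma exists_caseIII : ∃ a b c i j : ℕ, Admissible a b c ∧ IsLeast (posetS a b c) (i, j) ∧
    CaseIII K a b c i j := by
  have h : Admissible 1 4 6 := by norm_num [Admissible]
  obtain ⟨i, j, hl⟩ := exists_isLeast_posetS h
  have h21 : (2, 1) ∈ posetS 1 4 6 := (mem_posetS_iff h).2 (by norm_num)
  have hi : i ≤ 2 := (hl.2 h21).1
  have hp : ∀ p r, DeadPair 1 4 6 p r → 2 ≤ p := by
    intro p r hd
    obtain ⟨p', r', hp, -, s, r₀, hs, -, h1, h2⟩ := (deadPair_iff h).1 hd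
    omega
  have hA : ¬ DeadPair 1 4 6 (ell 1 4 6) (emm 1 4 6) := fun hd => by
    have h1 := hp _ _ hd
    have h2 : ell 1 4 6 = 1 := by norm_num [ell]
    omega
  refine ⟨1, 4, 6, i, j, h, hl, caseIII_of K h hA (minPairs_eq_singleton h hl fun p r hd => ?_)⟩
  have := hd.le_of_isLeast h hl
  have := hp p r hd
  omega

lemma exists_caseIV : ∃ a b c i j : ℕ, Admissible a b c ∧ IsLeast (posetS a b c) (i, j) ∧
    CaseIV K a b c i j := by
  have h : Admissible 2 12 15 := by norm_num [Admissible]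
  obtain ⟨i, j, hl⟩ := exists_isLeast_posetS h
  have hm : emm 2 12 15 = 3 := by norm_num [emm]
  have hA : ¬ DeadPair 2 12 15 (ell 2 12 15) (emm 2 12 15) := fun hd => by
    obtain ⟨p', r', hp, -, s, r₀, hs, -, h1, h2⟩ := (deadPair_iff h).1 hd
    have h3 : ell 2 12 15 = 2 := by norm_num [ell]
    rw [h3] at hp
    interval_cases p' <;> interval_cases s <;> omega
  have h32 : DeadPair 2 12 15 3 2 :=
    Dominated.deadPair h ⟨1, 1, by norm_num, by norm_num, by norm_num, by norm_num⟩
  have hi : 3 < i := by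
    by_contra! hi
    obtain ⟨h1, h2, h3, h4⟩ := (mem_posetS_iff h).1 hl.1
    omega
  exact ⟨2, 12, 15, i, j, h, hl, caseIV_of K h hl hA
    (minPairs_ne_singleton hi h32 (Or.inr (by omega)))⟩

end Main

end SymmetricFiberCone

theorem theorem3p2 (K : Type*) [Field K] :
    (∀ a b c : ℕ, SymmetricFiberCone.Admissible a b c →
      ∃ i j : ℕ, IsLeast (SymmetricFiberCone.posetS a b c) (i, j) ∧
        (SymmetricFiberCone.CaseI K a b c i j ∨ SymmetricFiberCone.CaseII K a b c i j ∨
          SymmetricFiberCone.CaseIII K a b c i j ∨ SymmetricFiberCone.CaseIV K a b c i j) ∧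
        (SymmetricFiberCone.FiberCone.IsCohenMacaulay (SymmetricFiberCone.maxIdeal K)
            (SymmetricFiberCone.symmIdeal K a b c) ↔
          SymmetricFiberCone.CaseI K a b c i j) ∧
        (¬ SymmetricFiberCone.CaseI K a b c i j →
          SymmetricFiberCone.FiberCone.depth (SymmetricFiberCone.maxIdeal K)
            (SymmetricFiberCone.symmIdeal K a b c) = 1)) ∧
    (∃ a b c i j : ℕ, SymmetricFiberCone.Admissible a b c ∧
      IsLeast (SymmetricFiberCone.posetS a b c) (i, j) ∧
      SymmetricFiberCone.CaseI K a b c i j) ∧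
    (∃ a b c i j : ℕ, SymmetricFiberCone.Admissible a b c ∧
      IsLeast (SymmetricFiberCone.posetS a b c) (i, j) ∧
      SymmetricFiberCone.CaseII K a b c i j) ∧
    (∃ a b c i j : ℕ, SymmetricFiberCone.Admissible a b c ∧
      IsLeast (SymmetricFiberCone.posetS a b c) (i, j) ∧
      SymmetricFiberCone.CaseIII K a b c i j) ∧
    (∃ a b c i j : ℕ, SymmetricFiberCone.Admissible a b c ∧
      IsLeast (SymmetricFiberCone.posetS a b c) (i, j) ∧
      SymmetricFiberCone.CaseIV K a b c i j) := by
  refine ⟨fun a b c h => ?_, SymmetricFiberCone.exists_caseI K, SymmetricFiberCone.exists_caseII K,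
    SymmetricFiberCone.exists_caseIII K, SymmetricFiberCone.exists_caseIV K⟩
  obtain ⟨i, j, hl⟩ := SymmetricFiberCone.exists_isLeast_posetS h
  refine ⟨i, j, hl, ?_, SymmetricFiberCone.isCohenMacaulay_iff h hl, fun hI => ?_⟩
  · by_cases hA : SymmetricFiberCone.DeadPair a b c (SymmetricFiberCone.ell a b c)
      (SymmetricFiberCone.emm a b c) <;>
    by_cases hM : SymmetricFiberCone.minPairs a b c = {(i, j)}
    · exact Or.inl (SymmetricFiberCone.caseI_of K h hA hM)
    · exact Or.inr (Or.inl (SymmetricFiberCone.caseII_of K h hl hA hM))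
    · exact Or.inr (Or.inr (Or.inl (SymmetricFiberCone.caseIII_of K h hA hM)))
    · exact Or.inr (Or.inr (Or.inr (SymmetricFiberCone.caseIV_of K h hl hA hM)))
  · rw [SymmetricFiberCone.caseI_iff h hl] at hI
    exact SymmetricFiberCone.fiberCone_depth_eq_one h hl hI
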